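/- Let $C\subseteq\{+1,-1\}^n$ ($n\ge 1$) be a nonempty binary code of rate $R=\frac1n\log_2|C|$. Let $X$ be uniform on $C$, and for $\gamma\ge 0$ let $Y_k=\sqrt{\gamma}\,X_k+N_k$ ($1\le k\le n$), where $N_1,\dots,N_n$ are i.i.d. standard Gaussians independent of $X$ (the a priori AWGN channel, of signal-to-noise ratio $\gamma=\gamma_{ap}$). The extrinsic MMSE of $C$ is $$\mathrm{MMSE}_{ext}^{C}(\gamma)=\frac1n\sum_{k=1}^n E\big[(X_k-E[X_k\mid Y_j,\ j\ne k])^2\big],$$ and the extrinsic log-likelihood ratio of the $k$-th bit is $$L_{ext,k}=\log\frac{P(X_k=1\mid Y_j,\ j\neq k)}{P(X_k=-1\mid Y_j,\ j\ne k)}.$$ Say that $C$ satisfies the Gaussian assumption if for every $\gamma\ge0$ there is a $g\ge 0$ (the extrinsic signal-to-noise ratio) such that, for every $k$, the pair $(X_k,L_{ext,k})$ has the same joint law as $(X',\,2\sqrt g\,(\sqrt g\,X'+N'))$, where $X'$ is uniform on $\{+1,-1\}$ and $N'$ is an independent standard Gaussian; that is, $X_k$ is equiprobable and $L_{ext,k}$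 is distributed as the log-likelihood ratio of an equiprobable bit sent over an AWGN channel of signal-to-noise ratio $g$. Let $C_1$, $C_2$ be two binary codes (possibly of different lengths), of rates $R_1$, $R_2$, both satisfying the Gaussian assumption, such that $$1-\mathrm{MMSE}_{ext}^{C_1}(\gamma_{ap})\le 1-\mathrm{MMSE}_{ext}^{C_2}(\gamma_{ap})\quad\text{for all }\gamma_{ap}\ge0 .$$ Then $R_1\ge R_2$, with equality only when the two curves coincide, i.e. only when $\mathrm{MMSE}_{ext}^{C_1}(\gamma_{ap})=\mathrm{MMSE}_{ext}^{C_2}(\gamma_{ap})$ for all $\gamma_{ap}\ge0$. -/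

import Mathlib

open MeasureTheory ProbabilityTheory

noncomputable section

namespace GaussCode

/-- Antipodal signalling: the bit `true` is sent as `+1` and `false` as `-1`. -/
def bpsk (b : Bool) : ℝ := if b then 1 else -1

/-- Sample space for a length `n` transmission: a codeword together with the noise vector. -/
abbrev Sample (n : ℕ) : Type := (Fin n → Bool) × (Fin n → ℝ)

/-- The law of (codeword, noise): the codeword is uniform on the code `C`, and the noise samples
are independent standard Gaussians, independent of the codeword. -/
def codeMeasure {n : ℕ} (C : Finset (Fin n → Bool)) : Measure (Sample n) :=
  (uniformOn (C : Set (Fin n → Bool))).prod (Measure.pi fun _ => gaussianReal 0 1)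

/-- The `k`-th transmitted symbol `X_k`, with values in `{+1, -1}`. -/
def symbol {n : ℕ} (k : Fin n) (ω : Sample n) : ℝ := bpsk (ω.1 k)

/-- The output `Y_k = √γ X_k + N_k` of the a priori AWGN channel of signal to noise ratio `γ`. -/
def received {n : ℕ} (γ : ℝ) (k : Fin n) (ω : Sample n) : ℝ := √γ * symbol k ω + ω.2 k

/-- The σ-algebra generated by all a priori observations except the `k`-th,
i.e. by `Y_j`, `j ≠ k`. -/
abbrev extrinsicAlgebra {n : ℕ} (γ : ℝ) (k : Fin n) : MeasurableSpace (Sample n) :=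
  MeasurableSpace.comap (fun ω (j : {j : Fin n // j ≠ k}) => received γ j.1 ω) inferInstance

/-- The extrinsic minimum mean squared error of the code at a priori signal to noise ratio `γ`:
the average over `k` of `E[(X_k - E[X_k | Y_j, j ≠ k])²]`. -/
def mmseExt {n : ℕ} (C : Finset (Fin n → Bool)) (γ : ℝ) : ℝ :=
  (1 / (n : ℝ)) * ∑ k : Fin n,
    ∫ ω, (symbol k ω - ((codeMeasure C)[symbol k | extrinsicAlgebra γ k]) ω) ^ 2 ∂(codeMeasure C)

/-- The extrinsic log likelihood ratio of the `k`-th bit,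
`log (P(X_k = 1 | Y_j, j ≠ k) / P(X_k = -1 | Y_j, j ≠ k))`. -/
def extLLR {n : ℕ} (C : Finset (Fin n → Bool)) (γ : ℝ) (k : Fin n) (ω : Sample n) : ℝ :=
  Real.log
    (((codeMeasure C)⟦{ω' : Sample n | ω'.1 k = true} | extrinsicAlgebra γ k⟧) ω /
      ((codeMeasure C)⟦{ω' : Sample n | ω'.1 k = false} | extrinsicAlgebra γ k⟧) ω)

/-- The joint law of `(X, L)`, where `X` is an equiprobable bit and `L = 2 √g Y` is the log
likelihood ratio of `X` given the output `Y = √g X + N` of an AWGN channel of signal to noise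
ratio `g`. Given `X`, the variable `L` is Gaussian of mean `2 g X` and variance `4 g`. -/
def awgnLLRLaw (g : ℝ) : Measure (Bool × ℝ) :=
  ((uniformOn (Set.univ : Set Bool)).prod (gaussianReal 0 1)).map
    fun p => (p.1, 2 * √g * (√g * bpsk p.1 + p.2))

/-- The Gaussian assumption on the extrinsic information: at every a priori signal to noise ratio
`γ` there is an extrinsic signal to noise ratio `g` such that, for every position `k`, the bit and
its extrinsic log likelihood ratio are distributed as if the (equiprobable) bit had been sent over
an AWGN channel of signal to noise ratio `g`. -/
def GaussianExtrinsic {n : ℕ} (C : Finset (Fin n → Bool)) : Prop :=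
  ∀ γ : ℝ, 0 ≤ γ → ∃ g : ℝ, 0 ≤ g ∧ ∀ k : Fin n,
    (codeMeasure C).map (fun ω => (ω.1 k, extLLR C γ k ω)) = awgnLLRLaw g

/-- The rate of a binary code, in bits per channel use. -/
def rate {n : ℕ} (C : Finset (Fin n → Bool)) : ℝ := Real.logb 2 (C.card : ℝ) / (n : ℝ)

end GaussCode

end

/-
Measure the channel by its amplitude `s = √γ`. By the I-MMSE relation of Guo, Shamai and Verdú the
conditional entropy `H(X | Y)` has derivative `-s` times the sum over the positions of the mean
squared errors of the posterior means given the whole output; it starts at `log |C|` when `s = 0`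
and tends to `0` at infinity, so the rate is the area under the corresponding curve.

Under the Gaussian assumption, with extrinsic signal-to-noise ratio `g`, the bit `X k` times half
its extrinsic log-likelihood ratio is Gaussian of mean and variance `g`. The observation of `X k`
itself is independent of it and contributes `γ`, so both error curves are governed by the same
strictly increasing function `q`: the extrinsic error is `1 - q g`, the error given the whole output
is `1 - q (g + γ)`. An inequality between the extrinsic errors of two codes is thus one between
their `g`, hence one between the slopes of their normalized conditional entropies, whose difference
is decreasing with limit `0`, so its value at `s = 0` is nonnegative, and if that value is `0` the
difference is constant, which forces the `g` to agree.
-/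

noncomputable section

namespace GaussCode

lemma hasDerivAt_tanh (x : ℝ) : HasDerivAt Real.tanh (1 - Real.tanh x ^ 2) x := by
  have h := (Real.hasDerivAt_sinh x).div (Real.hasDerivAt_cosh x) (Real.cosh_pos x).ne'
  rw [show Real.sinh / Real.cosh = Real.tanh from
    funext fun y => (Real.tanh_eq_sinh_div_cosh y).symm] at h
  refine h.congr_deriv ?_
  rw [Real.tanh_eq_sinh_div_cosh]
  field_simp [(Real.cosh_pos x).ne']

@[fun_prop]
lemma continuous_tanh : Continuous Real.tanh :=
  continuous_iff_continuousAt.2 fun x => (hasDerivAt_tanh x).continuousAt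

lemma one_sub_sq_tanh_pos (x : ℝ) : 0 < 1 - Real.tanh x ^ 2 :=
  sub_pos.2 (Real.tanh_sq_lt_one x)

lemma abs_one_sub_sq_tanh_le_one (x : ℝ) : |1 - Real.tanh x ^ 2| ≤ 1 :=
  abs_le.2 ⟨by linarith [one_sub_sq_tanh_pos x], by linarith [sq_nonneg (Real.tanh x)]⟩

lemma hasDerivAt_gaussianPDFReal (x : ℝ) :
    HasDerivAt (gaussianPDFReal 0 1) (-(x * gaussianPDFReal 0 1 x)) x := by
  have h : HasDerivAt (fun x : ℝ => -(x - 0) ^ 2 / (2 * (1 : NNReal))) (-x) x := by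
    refine ((((hasDerivAt_id x).sub_const 0).pow 2).neg.div_const _).congr_deriv ?_
    simp [neg_div]
  refine (h.exp.const_mul _).congr_deriv ?_
  rw [gaussianPDFReal]
  ring

lemma integrable_gaussianReal_iff {f : ℝ → ℝ} :
    Integrable f (gaussianReal 0 1) ↔ Integrable fun t => gaussianPDFReal 0 1 t * f t := by
  rw [gaussianReal_of_var_ne_zero _ one_ne_zero,
    integrable_withDensity_iff_integrable_smul' (measurable_gaussianPDF 0 1)
      (ae_of_all _ fun _ => gaussianPDF_lt_top)]
  simp only [toReal_gaussianPDF, smul_eq_mul]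

lemma integrable_id_gaussianReal : Integrable (fun t : ℝ => t) (gaussianReal 0 1) :=
  (memLp_id_gaussianReal 1).integrable (by simp)

lemma integral_id_mul_gaussianReal {f f' : ℝ → ℝ} (hf : ∀ x, HasDerivAt f (f' x) x)
    (hf_int : Integrable f (gaussianReal 0 1))
    (hid : Integrable (fun t => t * f t) (gaussianReal 0 1))
    (hf' : Integrable f' (gaussianReal 0 1)) :
    ∫ t, t * f t ∂gaussianReal 0 1 = ∫ t, f' t ∂gaussianReal 0 1 := by
  rw [integrable_gaussianReal_iff] at hf_int hid hf'
  have parts := integral_mul_deriv_eq_deriv_mul_of_integrable (v := gaussianPDFReal 0 1)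
    (fun x _ => hf x) (fun x _ => hasDerivAt_gaussianPDFReal x)
    (hid.neg.congr (ae_of_all _ fun t => by
      simp only [Pi.neg_apply, Pi.mul_apply]; ring))
    (hf'.congr (ae_of_all _ fun t => mul_comm _ _))
    (hf_int.congr (ae_of_all _ fun t => mul_comm _ _))
  simp only [mul_neg, integral_neg, neg_inj] at parts
  simp only [integral_gaussianReal_eq_integral_smul one_ne_zero, smul_eq_mul]
  calc ∫ t, gaussianPDFReal 0 1 t * (t * f t)
      = ∫ t, f t * (t * gaussianPDFReal 0 1 t) := by congr 1; ext t; ring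
    _ = ∫ t, f' t * gaussianPDFReal 0 1 t := parts
    _ = ∫ t, gaussianPDFReal 0 1 t * f' t := by simp only [mul_comm]

lemma integrable_tanh_affine (a s : ℝ) :
    Integrable (fun t => Real.tanh (a + s * t)) (gaussianReal 0 1) :=
  .of_bound (by fun_prop) 1 (ae_of_all _ fun _ => (Real.abs_tanh_lt_one _).le)

lemma integrable_one_sub_sq_tanh_affine (a s : ℝ) :
    Integrable (fun t => 1 - Real.tanh (a + s * t) ^ 2) (gaussianReal 0 1) :=
  .of_bound (by fun_prop) 1 (ae_of_all _ fun _ => abs_one_sub_sq_tanh_le_one _)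

lemma integrable_id_mul_one_sub_sq_tanh (a s : ℝ) :
    Integrable (fun t => t * (1 - Real.tanh (a + s * t) ^ 2)) (gaussianReal 0 1) :=
  integrable_id_gaussianReal.mul_bdd (integrable_one_sub_sq_tanh_affine a s).1
    (ae_of_all _ fun _ => abs_one_sub_sq_tanh_le_one _)

lemma integral_id_mul_one_sub_sq_tanh (a s : ℝ) :
    ∫ t, t * (1 - Real.tanh (a + s * t) ^ 2) ∂gaussianReal 0 1 =
      -(2 * s * ∫ t, Real.tanh (a + s * t) * (1 - Real.tanh (a + s * t) ^ 2)
        ∂gaussianReal 0 1) := by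
  have hderiv (t : ℝ) : HasDerivAt (fun t => 1 - Real.tanh (a + s * t) ^ 2)
      (-(2 * s * (Real.tanh (a + s * t) * (1 - Real.tanh (a + s * t) ^ 2)))) t := by
    have haff : HasDerivAt (fun t => a + s * t) s t := by
      simpa using ((hasDerivAt_id t).const_mul s).const_add a
    refine ((((hasDerivAt_tanh _).comp t haff).pow 2).const_sub 1).congr_deriv ?_
    simp only [Function.comp_apply]
    ring
  have hint := integrable_one_sub_sq_tanh_affine a s
  have hint_tanh := hint.bdd_mul (integrable_tanh_affine a s).1
    (ae_of_all _ fun _ => (Real.abs_tanh_lt_one _).le)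
  rw [integral_id_mul_gaussianReal hderiv hint (integrable_id_mul_one_sub_sq_tanh a s)
    (hint_tanh.const_mul _).neg, integral_neg, integral_const_mul]

lemma hasDerivAt_integral_tanh (s : ℝ) :
    HasDerivAt (fun s => ∫ t, Real.tanh (s ^ 2 + s * t) ∂gaussianReal 0 1)
      (∫ t, (2 * s + t) * (1 - Real.tanh (s ^ 2 + s * t) ^ 2) ∂gaussianReal 0 1) s := by
  have hbound (t x : ℝ) (hx : x ∈ Metric.ball s 1) :
      ‖(2 * x + t) * (1 - Real.tanh (x ^ 2 + x * t) ^ 2)‖ ≤ 2 * (|s| + 1) + |t| := by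
    have hx' : |x| ≤ |s| + 1 := by
      have := abs_sub_abs_le_abs_sub x s
      rw [Metric.mem_ball, Real.dist_eq] at hx
      linarith
    calc ‖(2 * x + t) * (1 - Real.tanh (x ^ 2 + x * t) ^ 2)‖ ≤ |2 * x + t| * 1 := by
          rw [norm_mul]
          exact mul_le_mul_of_nonneg_left (abs_one_sub_sq_tanh_le_one _) (abs_nonneg _)
      _ ≤ |2 * x| + |t| := by rw [mul_one]; exact abs_add_le _ _
      _ ≤ 2 * (|s| + 1) + |t| := by rw [abs_mul, abs_two]; gcongr
  have hderiv (t x : ℝ) : HasDerivAt (fun x => Real.tanh (x ^ 2 + x * t))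
      ((2 * x + t) * (1 - Real.tanh (x ^ 2 + x * t) ^ 2)) x := by
    have hquad : HasDerivAt (fun x : ℝ => x ^ 2 + x * t) (2 * x + t) x :=
      ((hasDerivAt_pow 2 x).add ((hasDerivAt_id x).mul_const t)).congr_deriv (by simp)
    exact ((hasDerivAt_tanh _).comp x hquad).congr_deriv (mul_comm _ _)
  exact (hasDerivAt_integral_of_dominated_loc_of_deriv_le (Metric.ball_mem_nhds s one_pos)
    (.of_forall fun x => (integrable_tanh_affine _ x).1) (integrable_tanh_affine _ s)
    (by fun_prop) (ae_of_all _ hbound) ((integrable_const _).add integrable_id_gaussianReal.abs)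
    (ae_of_all _ fun t x _ => hderiv t x)).2

lemma integral_add_mul_one_sub_sq_tanh (s : ℝ) :
    ∫ t, (2 * s + t) * (1 - Real.tanh (s ^ 2 + s * t) ^ 2) ∂gaussianReal 0 1 =
      2 * s * ∫ t, (1 - Real.tanh (s ^ 2 + s * t) ^ 2) * (1 - Real.tanh (s ^ 2 + s * t))
        ∂gaussianReal 0 1 := by
  have hint := integrable_one_sub_sq_tanh_affine (s ^ 2) s
  have hint_tanh : Integrable (fun t => Real.tanh (s ^ 2 + s * t) *
      (1 - Real.tanh (s ^ 2 + s * t) ^ 2)) (gaussianReal 0 1) :=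
    hint.bdd_mul (integrable_tanh_affine _ s).1 (ae_of_all _ fun _ => (Real.abs_tanh_lt_one _).le)
  calc ∫ t, (2 * s + t) * (1 - Real.tanh (s ^ 2 + s * t) ^ 2) ∂gaussianReal 0 1
      = 2 * s * ∫ t, (1 - Real.tanh (s ^ 2 + s * t) ^ 2) ∂gaussianReal 0 1 +
          ∫ t, t * (1 - Real.tanh (s ^ 2 + s * t) ^ 2) ∂gaussianReal 0 1 := by
        simp only [add_mul]
        rw [integral_add (hint.const_mul _) (integrable_id_mul_one_sub_sq_tanh _ s),
          integral_const_mul]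
    _ = 2 * s * (∫ t, (1 - Real.tanh (s ^ 2 + s * t) ^ 2) ∂gaussianReal 0 1 -
          ∫ t, Real.tanh (s ^ 2 + s * t) * (1 - Real.tanh (s ^ 2 + s * t) ^ 2)
            ∂gaussianReal 0 1) := by
        rw [integral_id_mul_one_sub_sq_tanh]; ring
    _ = _ := by
        rw [← integral_sub hint hint_tanh]
        congr 2; ext t; ring

lemma strictMonoOn_integral_tanh :
    StrictMonoOn (fun s => ∫ t, Real.tanh (s ^ 2 + s * t) ∂gaussianReal 0 1) (Set.Ici 0) := by
  refine strictMonoOn_of_deriv_pos (convex_Ici 0)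
    (fun s _ => (hasDerivAt_integral_tanh s).continuousAt.continuousWithinAt) fun s hs => ?_
  rw [interior_Ici, Set.mem_Ioi] at hs
  have hpos (t : ℝ) :
      0 < (1 - Real.tanh (s ^ 2 + s * t) ^ 2) * (1 - Real.tanh (s ^ 2 + s * t)) :=
    mul_pos (one_sub_sq_tanh_pos _) (sub_pos.2 (Real.tanh_lt_one _))
  have hint : Integrable (fun t =>
      (1 - Real.tanh (s ^ 2 + s * t) ^ 2) * (1 - Real.tanh (s ^ 2 + s * t)))
      (gaussianReal 0 1) :=
    ((integrable_const 1).sub (integrable_tanh_affine _ s)).bdd_mul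
      (integrable_one_sub_sq_tanh_affine _ s).1
      (ae_of_all _ fun _ => abs_one_sub_sq_tanh_le_one _)
  rw [(hasDerivAt_integral_tanh s).deriv, integral_add_mul_one_sub_sq_tanh]
  refine mul_pos (by linarith)
    ((integral_pos_iff_support_of_nonneg (fun t => (hpos t).le) hint).2 ?_)
  rw [Function.support_eq_univ fun t => (hpos t).ne', measure_univ]
  exact one_pos

/-- `E[X · E[X | Y]]` for an equiprobable bit `X` observed through an AWGN channel of
signal-to-noise ratio `g`. The posterior mean is `tanh (L / 2)`, where `L` is the log-likelihood
ratio, so that the product is `tanh (X * L / 2)`, and `X * L / 2` has mean and variance `g`. -/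
def bitOverlap (g : ℝ) : ℝ := ∫ z, Real.tanh z ∂gaussianReal g g.toNNReal

lemma map_affine_gaussianReal (s : ℝ) :
    (gaussianReal 0 1).map (fun t => s ^ 2 + s * t) = gaussianReal (s ^ 2) (s ^ 2).toNNReal := by
  have hvar : NNReal.mk (s ^ 2) (sq_nonneg s) = (s ^ 2).toNNReal :=
    (Real.toNNReal_of_nonneg (sq_nonneg s)).symm
  have hscale := gaussianReal_map_const_mul (μ := 0) (v := 1) s
  have hshift := gaussianReal_map_const_add (μ := 0) (v := (s ^ 2).toNNReal) (s ^ 2)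
  rw [mul_zero, mul_one, hvar] at hscale
  rw [zero_add, ← hscale, Measure.map_map (by fun_prop) (by fun_prop)] at hshift
  exact hshift

lemma bitOverlap_sq (s : ℝ) :
    bitOverlap (s ^ 2) = ∫ t, Real.tanh (s ^ 2 + s * t) ∂gaussianReal 0 1 := by
  rw [bitOverlap, ← map_affine_gaussianReal, integral_map (by fun_prop) (by fun_prop)]

lemma strictMonoOn_bitOverlap : StrictMonoOn bitOverlap (Set.Ici 0) := by
  intro g hg g' hg' hlt
  rw [← Real.sq_sqrt hg, ← Real.sq_sqrt hg', bitOverlap_sq, bitOverlap_sq]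
  exact strictMonoOn_integral_tanh (Real.sqrt_nonneg _) (Real.sqrt_nonneg _)
    (Real.sqrt_lt_sqrt hg hlt)

section ProductMeasure

variable {ι : Type*} [Fintype ι] {α : ι → Type*} [∀ i, MeasurableSpace (α i)]

lemma pi_withDensity (μ : ∀ i, Measure (α i)) [∀ i, IsProbabilityMeasure (μ i)]
    {f : ∀ i, α i → ENNReal} (hf : ∀ i, Measurable (f i))
    [∀ i, SigmaFinite ((μ i).withDensity (f i))] :
    Measure.pi (fun i => (μ i).withDensity (f i)) =
      (Measure.pi μ).withDensity fun x => ∏ i, f i (x i) := by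
  refine Measure.pi_eq fun s hs => ?_
  have hrect : (Set.univ.pi s).indicator (fun x => ∏ i, f i (x i)) =
      fun x => ∏ i, (s i).indicator (f i) (x i) := by
    ext x
    by_cases hx : x ∈ Set.univ.pi s
    · rw [Set.indicator_of_mem hx]
      exact Finset.prod_congr rfl fun i _ => (Set.indicator_of_mem (hx i trivial) _).symm
    · obtain ⟨i, hi⟩ : ∃ i, x i ∉ s i := by simpa using hx
      rw [Set.indicator_of_notMem hx, Finset.prod_eq_zero (Finset.mem_univ i)]
      exact Set.indicator_of_notMem hi _
  have hmeas (i : ι) : Measurable ((s i).indicator (f i)) := (hf i).indicator (hs i)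
  have hindep := iIndepFun_pi (μ := μ) fun i => (hmeas i).aemeasurable
  rw [withDensity_apply _ (.univ_pi hs), ← lintegral_indicator (.univ_pi hs), hrect,
    lintegral_prod_eq_prod_lintegral_of_indepFun _ _ hindep
      fun i => (hmeas i).comp (measurable_pi_apply i)]
  refine Finset.prod_congr rfl fun i _ => ?_
  rw [withDensity_apply _ (hs i), ← lintegral_indicator (hs i)]
  exact (measurePreserving_eval μ i).lintegral_comp (hmeas i)

lemma measurePreserving_update [DecidableEq ι] (μ : ∀ i, Measure (α i))
    [∀ i, IsProbabilityMeasure (μ i)] (k : ι) :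
    MeasurePreserving (fun p : (∀ i, α i) × α k => Function.update p.1 k p.2)
      ((Measure.pi μ).prod (μ k)) (Measure.pi μ) := by
  refine ⟨measurable_update', (Measure.pi_eq fun s hs => ?_).symm⟩
  have hrect : (fun p : (∀ i, α i) × α k => Function.update p.1 k p.2) ⁻¹' Set.univ.pi s =
      Set.univ.pi (Function.update s k Set.univ) ×ˢ s k := by
    ext p
    simp only [Set.mem_preimage, Set.mem_univ_pi, Set.mem_prod]
    grind
  rw [Measure.map_apply measurable_update' (.univ_pi hs), hrect, Measure.prod_prod,
    Measure.pi_pi, ← Finset.mul_prod_erase _ _ (Finset.mem_univ k),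
    ← Finset.mul_prod_erase _ (fun i => μ i (s i)) (Finset.mem_univ k), Function.update_self,
    measure_univ, one_mul, mul_comm]
  congr 1
  exact Finset.prod_congr rfl fun i hi => by
    rw [Function.update_of_ne (Finset.ne_of_mem_erase hi)]

end ProductMeasure

lemma gaussianReal_eq_withDensity (c : ℝ) :
    gaussianReal c 1 = (gaussianReal 0 1).withDensity
      fun t => ENNReal.ofReal (Real.exp (c * t - c ^ 2 / 2)) := by
  rw [gaussianReal_of_var_ne_zero _ one_ne_zero, gaussianReal_of_var_ne_zero _ one_ne_zero,
    ← withDensity_mul _ (measurable_gaussianPDF 0 1) (by fun_prop)]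
  congr 1
  ext t
  rw [Pi.mul_apply, gaussianPDF, gaussianPDF, ← ENNReal.ofReal_mul (gaussianPDFReal_nonneg _ _ _)]
  simp only [gaussianPDFReal, mul_assoc, ← Real.exp_add, NNReal.coe_one]
  congr 3
  ring

section GaussianTranslation

variable {ι : Type*} [Fintype ι]

lemma map_const_add_pi_gaussianReal (c : ι → ℝ) :
    (Measure.pi fun _ => gaussianReal 0 1).map (c + ·) =
      (Measure.pi fun _ => gaussianReal 0 1).withDensity
        fun t => ENNReal.ofReal (Real.exp (∑ i, (c i * t i - c i ^ 2 / 2))) := by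
  have hshift (i : ι) : (gaussianReal 0 1).map (c i + ·) = gaussianReal (c i) 1 := by
    rw [gaussianReal_map_const_add, zero_add]
  have (i : ι) : SigmaFinite ((gaussianReal 0 1).map (c i + ·)) := by
    rw [hshift]; infer_instance
  have (i : ι) : SigmaFinite ((gaussianReal 0 1).withDensity
      fun t => ENNReal.ofReal (Real.exp (c i * t - c i ^ 2 / 2))) := by
    rw [← gaussianReal_eq_withDensity]; infer_instance
  calc (Measure.pi fun _ => gaussianReal 0 1).map (c + ·)
      = Measure.pi fun i => (gaussianReal 0 1).map (c i + ·) :=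
        Measure.pi_map_pi fun i => (measurable_const_add (c i)).aemeasurable
    _ = Measure.pi fun i => (gaussianReal 0 1).withDensity
          fun t => ENNReal.ofReal (Real.exp (c i * t - c i ^ 2 / 2)) := by
        congr 1
        ext1 i
        rw [hshift, gaussianReal_eq_withDensity]
    _ = _ := by
        rw [pi_withDensity _ fun i => by fun_prop]
        congr 1
        ext t
        rw [Real.exp_sum, ENNReal.ofReal_prod_of_nonneg fun _ _ => (Real.exp_pos _).le]

lemma integrable_const_add_pi_gaussianReal {c : ι → ℝ} {f : (ι → ℝ) → ℝ} :
    Integrable (fun t => f (c + t)) (Measure.pi fun _ => gaussianReal 0 1) ↔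
      Integrable (fun t => Real.exp (∑ i, (c i * t i - c i ^ 2 / 2)) * f t)
        (Measure.pi fun _ => gaussianReal 0 1) := by
  have hmap := integrable_map_equiv (μ := Measure.pi fun _ : ι => gaussianReal 0 1)
    (MeasurableEquiv.addLeft c) f
  rw [MeasurableEquiv.coe_addLeft, map_const_add_pi_gaussianReal,
    integrable_withDensity_iff_integrable_smul' (by fun_prop)
      (ae_of_all _ fun _ => ENNReal.ofReal_lt_top)] at hmap
  simpa only [Function.comp_def, ENNReal.toReal_ofReal (Real.exp_pos _).le, smul_eq_mul]
    using hmap.symm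

lemma integral_const_add_pi_gaussianReal (c : ι → ℝ) (f : (ι → ℝ) → ℝ) :
    ∫ t, f (c + t) ∂Measure.pi (fun _ => gaussianReal 0 1) =
      ∫ t, Real.exp (∑ i, (c i * t i - c i ^ 2 / 2)) * f t
        ∂Measure.pi (fun _ => gaussianReal 0 1) := by
  have hmap := integral_map_equiv (μ := Measure.pi fun _ : ι => gaussianReal 0 1)
    (MeasurableEquiv.addLeft c) f
  rw [MeasurableEquiv.coe_addLeft, map_const_add_pi_gaussianReal,
    integral_withDensity_eq_integral_toReal_smul (by fun_prop)
      (ae_of_all _ fun _ => ENNReal.ofReal_lt_top)] at hmap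
  simpa only [ENNReal.toReal_ofReal (Real.exp_pos _).le, smul_eq_mul] using hmap.symm

end GaussianTranslation

section SampleSpace

variable {n : ℕ} {C : Finset (Fin n → Bool)}

lemma bpsk_sq (b : Bool) : bpsk b ^ 2 = 1 := by cases b <;> simp [bpsk]

lemma abs_bpsk (b : Bool) : |bpsk b| = 1 := by cases b <;> simp [bpsk]

lemma isProbabilityMeasure_codeMeasure (hC : C.Nonempty) :
    IsProbabilityMeasure (codeMeasure C) := by
  have := isProbabilityMeasure_uniformOn C.finite_toSet hC
  unfold codeMeasure
  infer_instance

instance : IsFiniteMeasure (codeMeasure C) := by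
  unfold codeMeasure uniformOn
  infer_instance

lemma integral_uniformOn {α : Type*} [Finite α] [MeasurableSpace α]
    [MeasurableSingletonClass α] (s : Finset α) (f : α → ℝ) :
    ∫ x, f x ∂uniformOn (s : Set α) = (s.card : ℝ)⁻¹ * ∑ x ∈ s, f x := by
  rw [uniformOn, ProbabilityTheory.cond, integral_smul_measure, Measure.count_apply_finset,
    setIntegral_finset _ Integrable.of_finite.integrableOn]
  simp [measureReal_def]

lemma integral_codeMeasure {f : Sample n → ℝ} (hf : Integrable f (codeMeasure C)) :
    ∫ ω, f ω ∂codeMeasure C =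
      (C.card : ℝ)⁻¹ * ∑ x ∈ C, ∫ t, f (x, t) ∂Measure.pi fun _ => gaussianReal 0 1 := by
  rw [codeMeasure, integral_prod _ hf, integral_uniformOn]

lemma ae_codeword_mem : ∀ᵐ ω ∂codeMeasure C, ω.1 ∈ C :=
  Measure.quasiMeasurePreserving_fst.ae (ae_cond_mem C.measurableSet)

@[fun_prop]
lemma measurable_bpsk : Measurable bpsk := measurable_of_finite bpsk

@[fun_prop]
lemma measurable_symbol (k : Fin n) : Measurable (symbol (n := n) k) := by
  unfold symbol
  fun_prop

lemma abs_symbol (k : Fin n) (ω : Sample n) : |symbol k ω| = 1 := abs_bpsk _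

lemma symbol_sq (k : Fin n) (ω : Sample n) : symbol k ω ^ 2 = 1 := bpsk_sq _

lemma measurePreserving_noise (hC : C.Nonempty) (k : Fin n) :
    MeasurePreserving (fun ω : Sample n => ω.2 k) (codeMeasure C) (gaussianReal 0 1) := by
  have := isProbabilityMeasure_uniformOn C.finite_toSet hC
  exact (measurePreserving_eval _ k).comp measurePreserving_snd

lemma integrable_noise (hC : C.Nonempty) (k : Fin n) :
    Integrable (fun ω : Sample n => ω.2 k) (codeMeasure C) :=
  (measurePreserving_noise hC k).integrable_comp_of_integrable integrable_id_gaussianReal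

/-- The sample obtained from `ω` by replacing the `k`-th noise sample by `u`. -/
def replaceNoise (k : Fin n) (ω : Sample n) (u : ℝ) : Sample n :=
  (ω.1, Function.update ω.2 k u)

lemma measurePreserving_replaceNoise (k : Fin n) :
    MeasurePreserving (fun p : Sample n × ℝ => replaceNoise k p.1 p.2)
      ((codeMeasure C).prod (gaussianReal 0 1)) (codeMeasure C) := by
  unfold codeMeasure uniformOn
  exact ((MeasurePreserving.id _).prod (measurePreserving_update _ k)).comp
    (measurePreserving_prodAssoc _ _ _)

lemma integral_replaceNoise (k : Fin n) {f : Sample n → ℝ} (hf : Integrable f (codeMeasure C)) :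
    ∫ ω, f ω ∂codeMeasure C =
      ∫ ω, ∫ u, f (replaceNoise k ω u) ∂gaussianReal 0 1 ∂codeMeasure C := by
  have hmp := measurePreserving_replaceNoise (C := C) k
  rw [← hmp.hasLaw.integral_comp hf.1]
  exact integral_prod _ (hmp.integrable_comp_of_integrable hf)

lemma integral_noise_mul (k : Fin n) {f f' : Sample n → ℝ}
    (hderiv : ∀ ω u, HasDerivAt (fun u => f (replaceNoise k ω u)) (f' (replaceNoise k ω u)) u)
    (hf : Integrable f (codeMeasure C)) (hid : Integrable (fun ω => ω.2 k * f ω) (codeMeasure C))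
    (hf' : Integrable f' (codeMeasure C)) :
    ∫ ω, ω.2 k * f ω ∂codeMeasure C = ∫ ω, f' ω ∂codeMeasure C := by
  have hmp := measurePreserving_replaceNoise (C := C) k
  rw [integral_replaceNoise k hid, integral_replaceNoise k hf']
  refine integral_congr_ae ?_
  filter_upwards [(hmp.integrable_comp_of_integrable hf).prod_right_ae,
    (hmp.integrable_comp_of_integrable hid).prod_right_ae,
    (hmp.integrable_comp_of_integrable hf').prod_right_ae] with ω hω hω_id hω'
  have hcoord (u : ℝ) : (replaceNoise k ω u).2 k = u := Function.update_self ..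
  simp only [Function.comp_def, hcoord] at hω_id
  simp only [hcoord]
  exact integral_id_mul_gaussianReal (hderiv ω) hω hω_id hω'

end SampleSpace

section GibbsDistribution

variable {n : ℕ} {C : Finset (Fin n → Bool)}

/-- The weight `exp (∑ j, h j x j)` of the codeword `x` in the external field `h`: up to a factor
independent of `x`, the likelihood of `x` when the channel log-likelihood ratios are `2 h`. -/
def gibbsWeight (h : Fin n → ℝ) (x : Fin n → Bool) : ℝ := Real.exp (∑ j, h j * bpsk (x j))

/-- The partition function of the code `C` in the external field `h`. -/
def partitionFn (C : Finset (Fin n → Bool)) (h : Fin n → ℝ) : ℝ := ∑ x ∈ C, gibbsWeight h x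

/-- The mean of `φ` under the Gibbs distribution on the code `C`, that is, the posterior
distribution of the codeword in the external field `h`. -/
def gibbsMean (C : Finset (Fin n → Bool)) (φ : (Fin n → Bool) → ℝ) (h : Fin n → ℝ) : ℝ :=
  (∑ x ∈ C, φ x * gibbsWeight h x) / partitionFn C h

/-- The posterior mean of the `k`-th symbol in the external field `h`. -/
def bitMean (C : Finset (Fin n → Bool)) (k : Fin n) (h : Fin n → ℝ) : ℝ :=
  gibbsMean C (fun x => bpsk (x k)) h

lemma gibbsWeight_pos (h : Fin n → ℝ) (x : Fin n → Bool) : 0 < gibbsWeight h x := Real.exp_pos _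

lemma partitionFn_pos (hC : C.Nonempty) (h : Fin n → ℝ) : 0 < partitionFn C h :=
  Finset.sum_pos (fun _ _ => gibbsWeight_pos _ _) hC

lemma partitionFn_nonneg (h : Fin n → ℝ) : 0 ≤ partitionFn C h :=
  Finset.sum_nonneg fun _ _ => (gibbsWeight_pos _ _).le

@[fun_prop]
lemma continuous_gibbsWeight (x : Fin n → Bool) : Continuous fun h => gibbsWeight h x := by
  unfold gibbsWeight
  fun_prop

@[fun_prop]
lemma continuous_partitionFn : Continuous (partitionFn C) := by
  unfold partitionFn
  fun_prop

@[fun_prop]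
lemma measurable_gibbsMean (φ : (Fin n → Bool) → ℝ) : Measurable (gibbsMean C φ) := by
  unfold gibbsMean
  fun_prop

@[fun_prop]
lemma measurable_bitMean (k : Fin n) : Measurable (bitMean C k) := measurable_gibbsMean _

lemma gibbsMean_mul_partitionFn (φ : (Fin n → Bool) → ℝ) (h : Fin n → ℝ) :
    gibbsMean C φ h * partitionFn C h = ∑ x ∈ C, φ x * gibbsWeight h x := by
  rcases C.eq_empty_or_nonempty with rfl | hC
  · simp [partitionFn]
  · exact div_mul_cancel₀ _ (partitionFn_pos hC h).ne'

lemma sum_sub_gibbsMean_mul_gibbsWeight (φ : (Fin n → Bool) → ℝ) (h : Fin n → ℝ) :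
    ∑ x ∈ C, (φ x - gibbsMean C φ h) * gibbsWeight h x = 0 := by
  simp only [sub_mul]
  rw [Finset.sum_sub_distrib, ← Finset.mul_sum, ← partitionFn, gibbsMean_mul_partitionFn, sub_self]

lemma abs_gibbsMean_le {φ : (Fin n → Bool) → ℝ} {A : ℝ} (hφ : ∀ x, |φ x| ≤ A) (h : Fin n → ℝ) :
    |gibbsMean C φ h| ≤ A := by
  have hA : 0 ≤ A := (abs_nonneg _).trans (hφ default)
  rw [gibbsMean, abs_div, abs_of_nonneg (partitionFn_nonneg h)]
  refine div_le_of_le_mul₀ (partitionFn_nonneg h) hA ?_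
  rw [partitionFn, Finset.mul_sum]
  refine (Finset.abs_sum_le_sum_abs _ _).trans (Finset.sum_le_sum fun x _ => ?_)
  rw [abs_mul, abs_of_pos (gibbsWeight_pos h x)]
  exact mul_le_mul_of_nonneg_right (hφ x) (gibbsWeight_pos h x).le

lemma abs_bitMean_le_one (k : Fin n) (h : Fin n → ℝ) : |bitMean C k h| ≤ 1 :=
  abs_gibbsMean_le (fun _ => (abs_bpsk _).le) h

lemma gibbsWeight_update (h : Fin n → ℝ) (k : Fin n) (u : ℝ) (x : Fin n → Bool) :
    gibbsWeight (Function.update h k u) x =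
      (Real.cosh u + bpsk (x k) * Real.sinh u) * gibbsWeight (Function.update h k 0) x := by
  have hexp : Real.exp (u * bpsk (x k)) = Real.cosh u + bpsk (x k) * Real.sinh u := by
    cases x k
    · simp [bpsk, ← sub_eq_add_neg, Real.cosh_sub_sinh]
    · simp [bpsk, Real.cosh_add_sinh]
  have hsplit (v : ℝ) : ∑ j, Function.update h k v j * bpsk (x j) =
      v * bpsk (x k) + ∑ j ∈ Finset.univ.erase k, h j * bpsk (x j) := by
    rw [← Finset.add_sum_erase _ _ (Finset.mem_univ k), Function.update_self]
    congr 1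
    exact Finset.sum_congr rfl fun j hj => by
      rw [Function.update_of_ne (Finset.ne_of_mem_erase hj)]
  rw [gibbsWeight, gibbsWeight, hsplit, hsplit, zero_mul, zero_add, Real.exp_add, hexp]

lemma partitionFn_update (h : Fin n → ℝ) (k : Fin n) (u : ℝ) :
    partitionFn C (Function.update h k u) =
      (Real.cosh u + bitMean C k (Function.update h k 0) * Real.sinh u) *
        partitionFn C (Function.update h k 0) := by
  rw [add_mul, mul_right_comm, bitMean, gibbsMean_mul_partitionFn, partitionFn, partitionFn,
    Finset.mul_sum, Finset.sum_mul, ← Finset.sum_add_distrib]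
  exact Finset.sum_congr rfl fun x _ => by rw [gibbsWeight_update]; ring

lemma cosh_add_bitMean_mul_sinh_pos (hC : C.Nonempty) (h : Fin n → ℝ) (k : Fin n) (u : ℝ) :
    0 < Real.cosh u + bitMean C k (Function.update h k 0) * Real.sinh u := by
  refine pos_of_mul_pos_left ?_ (partitionFn_nonneg (C := C) (Function.update h k 0))
  rw [← partitionFn_update]
  exact partitionFn_pos hC _

lemma bitMean_update (hC : C.Nonempty) (h : Fin n → ℝ) (k : Fin n) (u : ℝ) :
    bitMean C k (Function.update h k u) =
      (Real.sinh u + bitMean C k (Function.update h k 0) * Real.cosh u) /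
        (Real.cosh u + bitMean C k (Function.update h k 0) * Real.sinh u) := by
  have hnum : ∑ x ∈ C, bpsk (x k) * gibbsWeight (Function.update h k u) x =
      (Real.sinh u + bitMean C k (Function.update h k 0) * Real.cosh u) *
        partitionFn C (Function.update h k 0) := by
    rw [add_mul, mul_right_comm, bitMean, gibbsMean_mul_partitionFn, partitionFn,
      Finset.mul_sum, Finset.sum_mul, ← Finset.sum_add_distrib]
    refine Finset.sum_congr rfl fun x _ => ?_
    rw [gibbsWeight_update]
    linear_combination
      Real.sinh u * gibbsWeight (Function.update h k 0) x * bpsk_sq (x k)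
  rw [bitMean, gibbsMean, hnum, partitionFn_update h k u,
    mul_div_mul_right _ _ (partitionFn_pos hC _).ne']

lemma hasDerivAt_bitMean_update (hC : C.Nonempty) (h : Fin n → ℝ) (k : Fin n) (u : ℝ) :
    HasDerivAt (fun u => bitMean C k (Function.update h k u))
      (1 - bitMean C k (Function.update h k u) ^ 2) u := by
  have hupdate := bitMean_update hC h k
  have hpos := cosh_add_bitMean_mul_sinh_pos hC h k u
  set m := bitMean C k (Function.update h k 0)
  rw [funext hupdate, hupdate]
  have hnum := (Real.hasDerivAt_sinh u).fun_add ((Real.hasDerivAt_cosh u).const_mul m)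
  have hden := (Real.hasDerivAt_cosh u).fun_add ((Real.hasDerivAt_sinh u).const_mul m)
  refine (hnum.fun_div hden hpos.ne').congr_deriv ?_
  field_simp

lemma gibbsMean_bit_eq (hC : C.Nonempty) (k : Fin n) (b : Bool) (h : Fin n → ℝ) :
    gibbsMean C (fun x => if x k = b then 1 else 0) h = (1 + bpsk b * bitMean C k h) / 2 := by
  have hind (b' : Bool) : (if b' = b then 1 else 0 : ℝ) = (1 + bpsk b * bpsk b') / 2 := by
    cases b <;> cases b' <;> norm_num [bpsk]
  refine mul_right_cancel₀ (partitionFn_pos hC h).ne' ?_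
  rw [div_mul_eq_mul_div, add_mul, mul_assoc, bitMean, gibbsMean_mul_partitionFn,
    gibbsMean_mul_partitionFn, one_mul, partitionFn, Finset.mul_sum, ← Finset.sum_add_distrib,
    Finset.sum_div]
  exact Finset.sum_congr rfl fun x _ => by rw [hind]; ring

lemma abs_bitMean_lt_one {k : Fin n} (hbit : ∀ b, ∃ x ∈ C, x k = b) (h : Fin n → ℝ) :
    |bitMean C k h| < 1 := by
  have hpos (b : Bool) : 0 < (1 + bpsk b * bitMean C k h) / 2 := by
    obtain ⟨x, hx, hxb⟩ := hbit b
    rw [← gibbsMean_bit_eq ⟨x, hx⟩]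
    refine div_pos (Finset.sum_pos' (fun y _ => ?_) ⟨x, hx, ?_⟩) (partitionFn_pos ⟨x, hx⟩ h)
    · exact mul_nonneg (by dsimp only; split_ifs <;> norm_num) (gibbsWeight_pos h y).le
    · simp only [if_pos hxb, one_mul]
      exact gibbsWeight_pos h x
  have htrue := hpos true
  have hfalse := hpos false
  simp only [bpsk, if_true, Bool.false_eq_true, if_false] at htrue hfalse
  exact abs_lt.2 ⟨by linarith, by linarith⟩

lemma tanh_add_artanh {m : ℝ} (hm : |m| < 1) (u : ℝ) :
    Real.tanh (u + Real.artanh m) =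
      (Real.sinh u + m * Real.cosh u) / (Real.cosh u + m * Real.sinh u) := by
  have hroot : √(1 - m ^ 2) ≠ 0 :=
    (Real.sqrt_pos.2 (sub_pos.2 ((sq_lt_one_iff_abs_lt_one m).2 hm))).ne'
  have hm' := abs_lt.1 hm
  rw [Real.tanh_eq_sinh_div_cosh, Real.sinh_add, Real.cosh_add, Real.sinh_artanh hm',
    Real.cosh_artanh hm', ← mul_div_mul_right _ _ hroot]
  congr 1 <;> field_simp

lemma bitMean_eq_tanh {k : Fin n} (hbit : ∀ b, ∃ x ∈ C, x k = b) (h : Fin n → ℝ) :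
    bitMean C k h = Real.tanh (h k + Real.artanh (bitMean C k (Function.update h k 0))) := by
  obtain ⟨x, hx, -⟩ := hbit true
  rw [tanh_add_artanh (abs_bitMean_lt_one hbit _), ← bitMean_update ⟨x, hx⟩,
    Function.update_eq_self]

lemma hasDerivAt_log_partitionFn (hC : C.Nonempty) {h : ℝ → Fin n → ℝ} {h' : Fin n → ℝ} {s : ℝ}
    (hh : ∀ j, HasDerivAt (fun s => h s j) (h' j) s) :
    HasDerivAt (fun s => Real.log (partitionFn C (h s)))
      (∑ j, h' j * bitMean C j (h s)) s := by
  have hweight (x : Fin n → Bool) : HasDerivAt (fun s => gibbsWeight (h s) x)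
      (gibbsWeight (h s) x * ∑ j, h' j * bpsk (x j)) s :=
    (HasDerivAt.fun_sum fun j _ => (hh j).mul_const _).exp
  have hsum := HasDerivAt.fun_sum fun x (_ : x ∈ C) => hweight x
  refine (hsum.log (partitionFn_pos hC _).ne').congr_deriv ?_
  rw [← partitionFn, div_eq_iff (partitionFn_pos hC _).ne', Finset.sum_mul]
  simp only [Finset.mul_sum, mul_assoc, bitMean, gibbsMean_mul_partitionFn]
  rw [Finset.sum_comm]
  exact Finset.sum_congr rfl fun j _ => Finset.sum_congr rfl fun x _ => by ring

end GibbsDistribution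

section Channel

variable {n : ℕ} {C : Finset (Fin n → Bool)}

/-- The output of `n` parallel Gaussian channels, the `j`-th of amplitude `a j`. The a priori
observations have all amplitudes equal to `√γ`; a vanishing amplitude erases a position. -/
def channelOutput (a : Fin n → ℝ) (ω : Sample n) : Fin n → ℝ :=
  fun j => a j * symbol j ω + ω.2 j

/-- The external field produced by the channel output, half the channel log-likelihood ratios. -/
def channelField (a : Fin n → ℝ) (ω : Sample n) : Fin n → ℝ := a * channelOutput a ω

@[fun_prop]
lemma measurable_channelOutput (a : Fin n → ℝ) : Measurable (channelOutput a) := by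
  unfold channelOutput
  fun_prop

@[fun_prop]
lemma measurable_channelField (a : Fin n → ℝ) : Measurable (channelField a) := by
  unfold channelField
  fun_prop

lemma integrable_gibbsMean_channelField (φ : (Fin n → Bool) → ℝ) (a : Fin n → ℝ) :
    Integrable (fun ω => gibbsMean C φ (channelField a ω)) (codeMeasure C) := by
  obtain ⟨A, hA⟩ := Finite.exists_le fun x => |φ x|
  exact .of_bound (Measurable.aestronglyMeasurable (by fun_prop)) A
    (ae_of_all _ fun _ => abs_gibbsMean_le hA _)

lemma integrable_comp_codeword (φ : (Fin n → Bool) → ℝ) :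
    Integrable (fun ω : Sample n => φ ω.1) (codeMeasure C) := by
  obtain ⟨A, hA⟩ := Finite.exists_le fun x => |φ x|
  exact .of_bound ((measurable_of_finite φ).comp measurable_fst).aestronglyMeasurable A
    (ae_of_all _ fun ω => hA ω.1)

lemma exp_sum_eq_mul_gibbsWeight (a t : Fin n → ℝ) (x : Fin n → Bool) :
    Real.exp (∑ j, (a j * bpsk (x j) * t j - (a j * bpsk (x j)) ^ 2 / 2)) =
      Real.exp (-∑ j, a j ^ 2 / 2) * gibbsWeight (a * t) x := by
  rw [gibbsWeight, ← Real.exp_add, ← Finset.sum_neg_distrib, ← Finset.sum_add_distrib]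
  congr 1
  refine Finset.sum_congr rfl fun j _ => ?_
  rw [mul_pow, bpsk_sq, Pi.mul_apply]
  ring

lemma integral_comp_channelOutput (a : Fin n → ℝ) {G : (Fin n → Bool) → (Fin n → ℝ) → ℝ}
    (hG : Integrable (fun ω => G ω.1 (channelOutput a ω)) (codeMeasure C)) :
    ∫ ω, G ω.1 (channelOutput a ω) ∂codeMeasure C =
      (C.card : ℝ)⁻¹ * ∑ x ∈ C, ∫ t, Real.exp (-∑ j, a j ^ 2 / 2) * gibbsWeight (a * t) x * G x t
        ∂Measure.pi fun _ => gaussianReal 0 1 := by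
  rw [integral_codeMeasure hG]
  congr 1
  refine Finset.sum_congr rfl fun x _ => ?_
  simp only [← exp_sum_eq_mul_gibbsWeight]
  exact integral_const_add_pi_gaussianReal (fun j => a j * bpsk (x j)) (G x)

/-- Bayes' rule in weak form: the likelihood of the codeword `x` given the channel output `y` is
proportional to `gibbsWeight (a * y) x`. -/
lemma integral_sub_gibbsMean_mul (φ : (Fin n → Bool) → ℝ) (a : Fin n → ℝ) {ψ : (Fin n → ℝ) → ℝ}
    (hψ : Measurable ψ) {B : ℝ} (hB : ∀ y, |ψ y| ≤ B) :
    ∫ ω, (φ ω.1 - gibbsMean C φ (channelField a ω)) * ψ (channelOutput a ω) ∂codeMeasure C = 0 := by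
  obtain ⟨A, hA⟩ := Finite.exists_le fun x => |φ x|
  set G : (Fin n → Bool) → (Fin n → ℝ) → ℝ := fun x y => (φ x - gibbsMean C φ (a * y)) * ψ y
  have hG_bound (x : Fin n → Bool) (y : Fin n → ℝ) : |G x y| ≤ (A + A) * B := by
    rw [abs_mul]
    exact mul_le_mul ((abs_sub _ _).trans (add_le_add (hA x) (abs_gibbsMean_le hA _))) (hB y)
      (abs_nonneg _) (by linarith [(abs_nonneg _).trans (hA x)])
  have hint : Integrable (fun ω => G ω.1 (channelOutput a ω)) (codeMeasure C) :=
    ((integrable_comp_codeword φ).sub (integrable_gibbsMean_channelField φ a)).mul_bdd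
      (hψ.comp (measurable_channelOutput a)).aestronglyMeasurable (ae_of_all _ fun _ => hB _)
  have hint_shift (x : Fin n → Bool) : Integrable
      (fun t => Real.exp (-∑ j, a j ^ 2 / 2) * gibbsWeight (a * t) x * G x t)
      (Measure.pi fun _ => gaussianReal 0 1) := by
    simp only [← exp_sum_eq_mul_gibbsWeight]
    exact integrable_const_add_pi_gaussianReal (c := fun j => a j * bpsk (x j)).1
      (.of_bound (by dsimp only [G]; exact Measurable.aestronglyMeasurable (by fun_prop)) _
        (ae_of_all _ fun _ => hG_bound x _))
  have hsum (t : Fin n → ℝ) :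
      ∑ x ∈ C, Real.exp (-∑ j, a j ^ 2 / 2) * gibbsWeight (a * t) x * G x t = 0 := by
    have hzero := sum_sub_gibbsMean_mul_gibbsWeight (C := C) φ (a * t)
    calc _ = Real.exp (-∑ j, a j ^ 2 / 2) * ψ t *
          ∑ x ∈ C, (φ x - gibbsMean C φ (a * t)) * gibbsWeight (a * t) x := by
          rw [Finset.mul_sum]
          exact Finset.sum_congr rfl fun x _ => by ring
      _ = 0 := by rw [hzero, mul_zero]
  refine (integral_comp_channelOutput a hint).trans ?_
  rw [← integral_finsetSum _ fun x _ => hint_shift x]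
  simp only [hsum, integral_zero, mul_zero]

/-- The external field is a sufficient statistic of the channel output for the codeword. -/
lemma condExp_comap_channelOutput {β : Type*} [MeasurableSpace β] (φ : (Fin n → Bool) → ℝ)
    {a : Fin n → ℝ} {p : (Fin n → ℝ) → β} (hp : Measurable p) {F : β → Fin n → ℝ}
    (hF : Measurable F) (hFp : ∀ y, F (p y) = a * y) :
    (codeMeasure C)[fun ω => φ ω.1 |
        MeasurableSpace.comap (fun ω => p (channelOutput a ω)) inferInstance] =ᵐ[codeMeasure C]
      fun ω => gibbsMean C φ (channelField a ω) := by
  have hmeas : Measurable fun ω => p (channelOutput a ω) := by fun_prop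
  have hφ := integrable_comp_codeword (C := C) φ
  have hgibbs := integrable_gibbsMean_channelField (C := C) φ a
  refine (ae_eq_condExp_of_forall_setIntegral_eq hmeas.comap_le hφ
    (fun _ _ _ => hgibbs.integrableOn) ?_ ?_).symm
  · rintro _ ⟨B, hB, rfl⟩ -
    rw [eq_comm, ← sub_eq_zero, ← integral_sub hφ.integrableOn hgibbs.integrableOn,
      ← integral_indicator (hmeas hB)]
    have horth := integral_sub_gibbsMean_mul (C := C) φ a (ψ := (p ⁻¹' B).indicator 1) (B := 1)
      (measurable_one.indicator (hp hB)) fun y => by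
        by_cases hy : y ∈ p ⁻¹' B <;> simp [hy]
    refine (integral_congr_ae (ae_of_all _ fun ω => ?_)).trans horth
    by_cases hω : p (channelOutput a ω) ∈ B <;> simp [hω]
  · have hcomp : (fun ω => gibbsMean C φ (channelField a ω)) =
        (gibbsMean C φ ∘ F) ∘ fun ω => p (channelOutput a ω) := by
      ext ω
      simp only [Function.comp_apply, hFp, channelField]
    rw [hcomp]
    exact (((measurable_gibbsMean φ).comp hF).comp
      (comap_measurable _)).stronglyMeasurable.aestronglyMeasurable

lemma integrable_bitMean (a : Fin n → ℝ) (k : Fin n) :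
    Integrable (fun ω => bitMean C k (channelField a ω)) (codeMeasure C) :=
  integrable_gibbsMean_channelField _ a

lemma integrable_symbol_mul_bitMean (a : Fin n → ℝ) (k : Fin n) :
    Integrable (fun ω => symbol k ω * bitMean C k (channelField a ω)) (codeMeasure C) :=
  (integrable_bitMean a k).bdd_mul (measurable_symbol k).aestronglyMeasurable
    (ae_of_all _ fun ω => (abs_symbol k ω).le)

lemma integrable_bitMean_sq (a : Fin n → ℝ) (k : Fin n) :
    Integrable (fun ω => bitMean C k (channelField a ω) ^ 2) (codeMeasure C) := by
  simp only [sq]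
  exact (integrable_bitMean a k).bdd_mul (integrable_bitMean a k).1
    (ae_of_all _ fun ω => abs_bitMean_le_one k _)

lemma integral_symbol_mul_bitMean (a : Fin n → ℝ) (k : Fin n) :
    ∫ ω, symbol k ω * bitMean C k (channelField a ω) ∂codeMeasure C =
      ∫ ω, bitMean C k (channelField a ω) ^ 2 ∂codeMeasure C := by
  have horth := integral_sub_gibbsMean_mul (C := C) (fun x => bpsk (x k)) a
    (ψ := fun y => bitMean C k (a * y)) (by fun_prop) fun y => abs_bitMean_le_one k (a * y)
  rw [← sub_eq_zero, ← integral_sub (integrable_symbol_mul_bitMean a k) (integrable_bitMean_sq a k),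
    ← horth]
  congr 1 with ω
  simp only [symbol, bitMean, channelField]
  ring

lemma integral_sq_symbol_sub_bitMean (hC : C.Nonempty) (a : Fin n → ℝ) (k : Fin n) :
    ∫ ω, (symbol k ω - bitMean C k (channelField a ω)) ^ 2 ∂codeMeasure C =
      1 - ∫ ω, symbol k ω * bitMean C k (channelField a ω) ∂codeMeasure C := by
  have := isProbabilityMeasure_codeMeasure hC
  have hint := (integrable_symbol_mul_bitMean (C := C) a k).const_mul 2
  have hexpand (ω : Sample n) : (symbol k ω - bitMean C k (channelField a ω)) ^ 2 =
      1 - 2 * (symbol k ω * bitMean C k (channelField a ω)) +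
        bitMean C k (channelField a ω) ^ 2 := by
    linear_combination symbol_sq k ω
  simp only [hexpand]
  rw [integral_add (by exact (integrable_const 1).sub hint) (integrable_bitMean_sq a k),
    integral_sub (integrable_const 1) hint, integral_const_mul, integral_const, probReal_univ,
    one_smul, ← integral_symbol_mul_bitMean]
  ring

end Channel

section Extrinsic

variable {n : ℕ} {C : Finset (Fin n → Bool)}

/-- The channel amplitudes of the a priori observations other than the `k`-th, which is erased. -/
def extrinsicAmplitude (γ : ℝ) (k : Fin n) : Fin n → ℝ := Function.update (fun _ => √γ) k 0

lemma condExp_extrinsicAlgebra (φ : (Fin n → Bool) → ℝ) (γ : ℝ) (k : Fin n) :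
    (codeMeasure C)[fun ω => φ ω.1 | extrinsicAlgebra γ k] =ᵐ[codeMeasure C]
      fun ω => gibbsMean C φ (channelField (extrinsicAmplitude γ k) ω) := by
  have hreceived : (fun ω (j : {j : Fin n // j ≠ k}) => received γ j.1 ω) =
      fun ω (j : {j : Fin n // j ≠ k}) => channelOutput (extrinsicAmplitude γ k) ω j.1 := by
    ext ω j
    simp [received, channelOutput, extrinsicAmplitude, Function.update_of_ne j.2]
  rw [extrinsicAlgebra, hreceived]
  refine condExp_comap_channelOutput φ
    (p := fun y (j : {j : Fin n // j ≠ k}) => y j.1)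
    (F := fun z j => if hj : j ≠ k then √γ * z ⟨j, hj⟩ else 0)
    (by fun_prop) (measurable_pi_lambda _ fun j => ?_) fun y => ?_
  · by_cases hj : j ≠ k
    · simp only [hj, ne_eq, not_false_eq_true, dite_true]
      fun_prop
    · simp only [hj, dite_false, measurable_const]
  · ext j
    by_cases hj : j = k
    · subst hj
      simp [extrinsicAmplitude]
    · simp [extrinsicAmplitude, hj]

lemma extLLR_ae_eq (hC : C.Nonempty) (γ : ℝ) (k : Fin n) :
    extLLR C γ k =ᵐ[codeMeasure C]
      fun ω => 2 * Real.artanh (bitMean C k (channelField (extrinsicAmplitude γ k) ω)) := by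
  have hbit (b : Bool) :
      (codeMeasure C)⟦{ω' : Sample n | ω'.1 k = b} | extrinsicAlgebra γ k⟧ =ᵐ[codeMeasure C]
        fun ω => (1 + bpsk b * bitMean C k (channelField (extrinsicAmplitude γ k) ω)) / 2 := by
    have hind : {ω' : Sample n | ω'.1 k = b}.indicator (fun _ => (1 : ℝ)) =
        fun ω => if ω.1 k = b then 1 else 0 := by
      ext ω
      simp [Set.indicator_apply]
    rw [hind]
    refine (condExp_extrinsicAlgebra (fun x => if x k = b then 1 else 0) γ k).trans ?_
    exact ae_of_all _ fun ω => gibbsMean_bit_eq hC k b _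
  filter_upwards [hbit true, hbit false] with ω htrue hfalse
  rw [extLLR, htrue, hfalse, Real.artanh_eq_half_log (abs_le.1 (abs_bitMean_le_one k _)),
    div_div_div_cancel_right₀ two_ne_zero]
  simp only [bpsk, if_true, Bool.false_eq_true, if_false]
  ring_nf

lemma mmseExt_eq (hC : C.Nonempty) (γ : ℝ) :
    mmseExt C γ = (1 / n : ℝ) * ∑ k,
      (1 - ∫ ω, symbol k ω * bitMean C k (channelField (extrinsicAmplitude γ k) ω)
        ∂codeMeasure C) := by
  rw [mmseExt]
  congr 1
  refine Finset.sum_congr rfl fun k _ => ?_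
  have hcond : (codeMeasure C)[symbol k | extrinsicAlgebra γ k] =ᵐ[codeMeasure C]
      fun ω => bitMean C k (channelField (extrinsicAmplitude γ k) ω) :=
    condExp_extrinsicAlgebra (fun x => bpsk (x k)) γ k
  rw [← integral_sq_symbol_sub_bitMean hC]
  refine integral_congr_ae ?_
  filter_upwards [hcond] with ω hω
  rw [hω]

end Extrinsic

section Surprisal

variable {n : ℕ} {C : Finset (Fin n → Bool)}

/-- Minus the logarithm of the posterior probability of the transmitted codeword, when all
channels have amplitude `s`. -/
def surprisal (C : Finset (Fin n → Bool)) (s : ℝ) (ω : Sample n) : ℝ :=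
  -Real.log (gibbsWeight (channelField (fun _ => s) ω) ω.1 /
    partitionFn C (channelField (fun _ => s) ω))

lemma surprisal_eq_sub (hC : C.Nonempty) (s : ℝ) (ω : Sample n) :
    surprisal C s ω = Real.log (partitionFn C (channelField (fun _ => s) ω)) -
      ∑ j, channelField (fun _ => s) ω j * symbol j ω := by
  rw [surprisal, Real.log_div (gibbsWeight_pos _ _).ne' (partitionFn_pos hC _).ne', gibbsWeight,
    Real.log_exp, neg_sub]
  rfl

@[fun_prop]
lemma measurable_surprisal (s : ℝ) : Measurable (surprisal C s) := by
  unfold surprisal gibbsWeight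
  fun_prop

lemma surprisal_nonneg (s : ℝ) {ω : Sample n} (hω : ω.1 ∈ C) : 0 ≤ surprisal C s ω := by
  refine neg_nonneg.2 (Real.log_nonpos
    (div_nonneg (gibbsWeight_pos _ _).le (partitionFn_nonneg _))
    (div_le_one_of_le₀ ?_ (partitionFn_nonneg _)))
  exact Finset.single_le_sum (f := gibbsWeight (channelField (fun _ => s) ω))
    (fun _ _ => (gibbsWeight_pos _ _).le) hω

lemma channelField_mul_le (s : ℝ) (ω : Sample n) (x : Fin n → Bool) (j : Fin n) :
    channelField (fun _ => s) ω j * bpsk (x j) ≤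
      channelField (fun _ => s) ω j * symbol j ω + ω.2 j ^ 2 -
        if x j = ω.1 j then 0 else s ^ 2 := by
  have hfield : channelField (fun _ => s) ω j = s * (s * bpsk (ω.1 j) + ω.2 j) := rfl
  rw [hfield, symbol]
  cases x j <;> cases ω.1 j <;>
    simp only [bpsk, if_true, Bool.false_eq_true, reduceCtorEq, if_false] <;>
    nlinarith [sq_nonneg (s + ω.2 j), sq_nonneg (s - ω.2 j), sq_nonneg (ω.2 j)]

lemma gibbsWeight_channelField_le (s : ℝ) {ω : Sample n} {x : Fin n → Bool} (hx : x ≠ ω.1) :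
    gibbsWeight (channelField (fun _ => s) ω) x ≤
      Real.exp (∑ j, ω.2 j ^ 2 - s ^ 2) * gibbsWeight (channelField (fun _ => s) ω) ω.1 := by
  rw [gibbsWeight, gibbsWeight, ← Real.exp_add, Real.exp_le_exp]
  obtain ⟨i, hi⟩ := Function.ne_iff.1 hx
  have hdiff : s ^ 2 ≤ ∑ j, if x j = ω.1 j then 0 else s ^ 2 := by
    refine le_of_eq_of_le (if_neg hi).symm (Finset.single_le_sum
      (f := fun j => if x j = ω.1 j then 0 else s ^ 2) (fun j _ => ?_) (Finset.mem_univ i))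
    split_ifs <;> positivity
  have hsum := Finset.sum_le_sum fun j (_ : j ∈ Finset.univ) => channelField_mul_le s ω x j
  rw [Finset.sum_sub_distrib, Finset.sum_add_distrib] at hsum
  simp only [symbol] at hsum
  linarith

lemma surprisal_le (s : ℝ) {ω : Sample n} (hω : ω.1 ∈ C) :
    surprisal C s ω ≤ Real.log (1 + C.card * Real.exp (∑ j, ω.2 j ^ 2 - s ^ 2)) := by
  set h := channelField (fun _ => s) ω
  set ε := Real.exp (∑ j, ω.2 j ^ 2 - s ^ 2)
  have hw := gibbsWeight_pos h ω.1
  have hpartition : partitionFn C h ≤ (1 + C.card * ε) * gibbsWeight h ω.1 := by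
    have herase : ∑ x ∈ C.erase ω.1, gibbsWeight h x ≤ C.card * (ε * gibbsWeight h ω.1) := by
      refine (Finset.sum_le_card_nsmul _ _ _ fun x hx =>
        gibbsWeight_channelField_le s (Finset.ne_of_mem_erase hx)).trans ?_
      rw [nsmul_eq_mul]
      gcongr
      exact Finset.erase_subset _ _
    rw [partitionFn, ← Finset.add_sum_erase _ _ hω]
    linarith
  rw [surprisal, ← Real.log_inv, inv_div]
  exact Real.log_le_log (div_pos (partitionFn_pos ⟨_, hω⟩ _) hw) ((div_le_iff₀ hw).2 hpartition)

lemma surprisal_le_add_sum_sq (s : ℝ) {ω : Sample n} (hω : ω.1 ∈ C) :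
    surprisal C s ω ≤ Real.log (1 + C.card) + ∑ j, ω.2 j ^ 2 := by
  have hsum : 0 ≤ ∑ j, ω.2 j ^ 2 := Finset.sum_nonneg fun _ _ => sq_nonneg _
  refine (surprisal_le s hω).trans ?_
  rw [← Real.log_exp (∑ j, ω.2 j ^ 2), ← Real.log_mul (by positivity) (Real.exp_pos _).ne',
    Real.log_exp]
  refine Real.log_le_log (by positivity) ?_
  have hone : 1 ≤ Real.exp (∑ j, ω.2 j ^ 2) := Real.one_le_exp hsum
  have hle : Real.exp (∑ j, ω.2 j ^ 2 - s ^ 2) ≤ Real.exp (∑ j, ω.2 j ^ 2) :=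
    Real.exp_le_exp.2 (by linarith [sq_nonneg s])
  rw [add_mul, one_mul]
  gcongr

lemma tendsto_surprisal {ω : Sample n} (hω : ω.1 ∈ C) :
    Filter.Tendsto (fun s => surprisal C s ω) Filter.atTop (nhds 0) := by
  have hexp : Filter.Tendsto (fun s : ℝ => Real.exp (∑ j, ω.2 j ^ 2 - s ^ 2)) Filter.atTop
      (nhds 0) :=
    Real.tendsto_exp_atBot.comp (Filter.tendsto_atBot_add_const_left _ _
      (Filter.tendsto_neg_atTop_atBot.comp (Filter.tendsto_pow_atTop two_ne_zero)))
  have hlog : Filter.Tendsto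
      (fun s : ℝ => Real.log (1 + C.card * Real.exp (∑ j, ω.2 j ^ 2 - s ^ 2))) Filter.atTop
      (nhds 0) := by
    simpa using ((hexp.const_mul (C.card : ℝ)).const_add 1).log (by simp)
  exact squeeze_zero (fun s => surprisal_nonneg s hω) (fun s => surprisal_le s hω) hlog

lemma hasDerivAt_surprisal (hC : C.Nonempty) (s : ℝ) (ω : Sample n) :
    HasDerivAt (fun s => surprisal C s ω)
      (∑ k, (2 * s * symbol k ω + ω.2 k) *
        (bitMean C k (channelField (fun _ => s) ω) - symbol k ω)) s := by
  have hfield (j : Fin n) : HasDerivAt (fun s => channelField (fun _ => s) ω j)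
      (2 * s * symbol j ω + ω.2 j) s := by
    refine ((hasDerivAt_id s).fun_mul
      (((hasDerivAt_id s).mul_const (symbol j ω)).add_const (ω.2 j))).congr_deriv ?_
    simp only [id_eq]
    ring
  simp only [surprisal_eq_sub hC]
  refine ((hasDerivAt_log_partitionFn hC hfield).sub
    (HasDerivAt.fun_sum fun j _ => (hfield j).mul_const _)).congr_deriv ?_
  rw [← Finset.sum_sub_distrib]
  exact Finset.sum_congr rfl fun k _ => (mul_sub _ _ _).symm

end Surprisal

section ConditionalEntropy

variable {n : ℕ} {C : Finset (Fin n → Bool)}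

/-- The conditional entropy, in nats, of the codeword given the outputs of the channels of
amplitude `s`, that is, of signal-to-noise ratio `s ^ 2`. -/
def condEntropy (C : Finset (Fin n → Bool)) (s : ℝ) : ℝ := ∫ ω, surprisal C s ω ∂codeMeasure C

lemma integrable_noise_sq (hC : C.Nonempty) (k : Fin n) :
    Integrable (fun ω : Sample n => ω.2 k ^ 2) (codeMeasure C) :=
  (measurePreserving_noise hC k).integrable_comp_of_integrable
    ((memLp_id_gaussianReal 2).integrable_sq)

lemma ae_norm_surprisal_le (s : ℝ) : ∀ᵐ ω ∂codeMeasure C,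
    ‖surprisal C s ω‖ ≤ Real.log (1 + C.card) + ∑ j, ω.2 j ^ 2 := by
  filter_upwards [ae_codeword_mem] with ω hω
  rw [Real.norm_of_nonneg (surprisal_nonneg s hω)]
  exact surprisal_le_add_sum_sq s hω

lemma integrable_log_card_add_sum_sq (hC : C.Nonempty) :
    Integrable (fun ω : Sample n => Real.log (1 + C.card) + ∑ j, ω.2 j ^ 2) (codeMeasure C) :=
  (integrable_const _).add (integrable_finsetSum _ fun j _ => integrable_noise_sq hC j)

lemma integrable_surprisal (hC : C.Nonempty) (s : ℝ) :
    Integrable (surprisal C s) (codeMeasure C) :=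
  (integrable_log_card_add_sum_sq hC).mono' (measurable_surprisal s).aestronglyMeasurable
    (ae_norm_surprisal_le s)

lemma tendsto_condEntropy (hC : C.Nonempty) :
    Filter.Tendsto (condEntropy C) Filter.atTop (nhds 0) := by
  rw [← integral_zero (Sample n) ℝ (μ := codeMeasure C)]
  exact tendsto_integral_filter_of_dominated_convergence _
    (.of_forall fun s => (measurable_surprisal s).aestronglyMeasurable)
    (.of_forall ae_norm_surprisal_le) (integrable_log_card_add_sum_sq hC)
    (ae_codeword_mem.mono fun _ => tendsto_surprisal)

lemma condEntropy_zero (hC : C.Nonempty) : condEntropy C 0 = Real.log C.card := by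
  have := isProbabilityMeasure_codeMeasure hC
  have hfield (ω : Sample n) : channelField (fun _ => 0) ω = 0 := zero_mul _
  simp [condEntropy, surprisal, hfield, gibbsWeight, partitionFn]

lemma rate_eq_condEntropy_zero (hC : C.Nonempty) :
    rate C = condEntropy C 0 / n / Real.log 2 := by
  rw [rate, Real.logb, condEntropy_zero hC, div_right_comm]

lemma channelField_replaceNoise (a : Fin n → ℝ) (k : Fin n) (ω : Sample n) (u : ℝ) :
    channelField a (replaceNoise k ω u) =
      Function.update (channelField a ω) k (a k * (a k * symbol k ω + u)) := by
  ext j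
  by_cases hj : j = k
  · subst hj
    simp [channelField, channelOutput, replaceNoise, symbol]
  · simp [channelField, channelOutput, replaceNoise, symbol, hj]

lemma abs_bitMean_sub_symbol_le (k : Fin n) (h : Fin n → ℝ) (ω : Sample n) :
    |bitMean C k h - symbol k ω| ≤ 2 := by
  linarith [abs_sub (bitMean C k h) (symbol k ω), abs_bitMean_le_one (C := C) k h, abs_symbol k ω]

lemma integrable_noise_mul_symbol (hC : C.Nonempty) (k : Fin n) :
    Integrable (fun ω => ω.2 k * symbol k ω) (codeMeasure C) :=
  (integrable_noise hC k).mul_bdd (measurable_symbol k).aestronglyMeasurable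
    (ae_of_all _ fun ω => (abs_symbol k ω).le)

lemma integral_noise_mul_symbol (hC : C.Nonempty) (k : Fin n) :
    ∫ ω, ω.2 k * symbol k ω ∂codeMeasure C = 0 := by
  rw [integral_noise_mul (f := symbol k) (f' := fun _ => 0) k
    (fun ω u => hasDerivAt_const u (symbol k ω)) (integrable_comp_codeword fun x => bpsk (x k))
    (integrable_noise_mul_symbol hC k) (integrable_zero ..), integral_zero]

lemma integrable_noise_mul_bitMean (hC : C.Nonempty) (a : Fin n → ℝ) (k : Fin n) :
    Integrable (fun ω => ω.2 k * bitMean C k (channelField a ω)) (codeMeasure C) :=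
  (integrable_noise hC k).mul_bdd (integrable_bitMean a k).1
    (ae_of_all _ fun _ => abs_bitMean_le_one k _)

lemma integral_noise_mul_bitMean (hC : C.Nonempty) (a : Fin n → ℝ) (k : Fin n) :
    ∫ ω, ω.2 k * bitMean C k (channelField a ω) ∂codeMeasure C =
      a k * (1 - ∫ ω, symbol k ω * bitMean C k (channelField a ω) ∂codeMeasure C) := by
  have := isProbabilityMeasure_codeMeasure hC
  have hderiv (ω : Sample n) (u : ℝ) :
      HasDerivAt (fun u => bitMean C k (channelField a (replaceNoise k ω u)))
        (a k * (1 - bitMean C k (channelField a (replaceNoise k ω u)) ^ 2)) u := by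
    have haff : HasDerivAt (fun u => a k * (a k * symbol k ω + u)) (a k) u := by
      simpa using ((hasDerivAt_id u).const_add (a k * symbol k ω)).const_mul (a k)
    simp only [channelField_replaceNoise]
    exact ((hasDerivAt_bitMean_update hC _ k _).comp u haff).congr_deriv (mul_comm _ _)
  have hint : Integrable (fun ω => 1 - bitMean C k (channelField a ω) ^ 2) (codeMeasure C) :=
    (integrable_const 1).sub (integrable_bitMean_sq a k)
  rw [integral_noise_mul k (f' := fun ω => a k * (1 - bitMean C k (channelField a ω) ^ 2)) hderiv
    (integrable_bitMean a k) (integrable_noise_mul_bitMean hC a k) (hint.const_mul _),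
    integral_const_mul, integral_sub (integrable_const 1) (integrable_bitMean_sq a k),
    integral_const, probReal_univ, one_smul, integral_symbol_mul_bitMean]

lemma integrable_deriv_surprisal (hC : C.Nonempty) (s : ℝ) (k : Fin n) :
    Integrable (fun ω => (2 * s * symbol k ω + ω.2 k) *
      (bitMean C k (channelField (fun _ => s) ω) - symbol k ω)) (codeMeasure C) := by
  have hsymbol : Integrable (symbol k) (codeMeasure C) :=
    integrable_comp_codeword fun x => bpsk (x k)
  exact ((hsymbol.const_mul _).add (integrable_noise hC k)).mul_bdd
    (Measurable.aestronglyMeasurable (by fun_prop))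
    (ae_of_all _ fun ω => abs_bitMean_sub_symbol_le k _ ω)

lemma integral_deriv_surprisal (hC : C.Nonempty) (s : ℝ) (k : Fin n) :
    ∫ ω, (2 * s * symbol k ω + ω.2 k) *
        (bitMean C k (channelField (fun _ => s) ω) - symbol k ω) ∂codeMeasure C =
      -(s * (1 - ∫ ω, symbol k ω * bitMean C k (channelField (fun _ => s) ω) ∂codeMeasure C)) := by
  have := isProbabilityMeasure_codeMeasure hC
  have hoverlap := (integrable_symbol_mul_bitMean (C := C) (fun _ => s) k).const_mul (2 * s)
  have hnoise := integrable_noise_mul_bitMean hC (fun _ => s) k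
  have hexpand (ω : Sample n) : (2 * s * symbol k ω + ω.2 k) *
      (bitMean C k (channelField (fun _ => s) ω) - symbol k ω) =
        (2 * s * (symbol k ω * bitMean C k (channelField (fun _ => s) ω)) - 2 * s) +
          (ω.2 k * bitMean C k (channelField (fun _ => s) ω) - ω.2 k * symbol k ω) := by
    linear_combination (-(2 * s)) * symbol_sq k ω
  simp only [hexpand]
  rw [integral_add (by exact hoverlap.sub (integrable_const (2 * s)))
      (by exact hnoise.sub (integrable_noise_mul_symbol hC k)),
    integral_sub hoverlap (integrable_const _),
    integral_sub hnoise (integrable_noise_mul_symbol hC k), integral_const_mul, integral_const,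
    probReal_univ, one_smul, integral_noise_mul_bitMean hC, integral_noise_mul_symbol hC]
  ring

/-- The I-MMSE relation of Guo, Shamai and Verdú, in the amplitude `s` instead of the
signal-to-noise ratio `s ^ 2`. -/
lemma hasDerivAt_condEntropy (hC : C.Nonempty) (s : ℝ) :
    HasDerivAt (condEntropy C)
      (-(s * ∑ k, (1 - ∫ ω, symbol k ω * bitMean C k (channelField (fun _ => s) ω)
        ∂codeMeasure C))) s := by
  have hderiv : HasDerivAt (condEntropy C)
      (∫ ω, ∑ k, (2 * s * symbol k ω + ω.2 k) *
        (bitMean C k (channelField (fun _ => s) ω) - symbol k ω) ∂codeMeasure C) s := by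
    refine (hasDerivAt_integral_of_dominated_loc_of_deriv_le (F := surprisal C)
      (bound := fun ω => ∑ k, (2 * (|s| + 1) + |ω.2 k|) * 2) (Metric.ball_mem_nhds s one_pos)
      (.of_forall fun s => (measurable_surprisal s).aestronglyMeasurable)
      (integrable_surprisal hC s) (Measurable.aestronglyMeasurable (by fun_prop))
      (ae_of_all _ fun ω x hx => ?_)
      (integrable_finsetSum _ fun k _ =>
        ((integrable_const _).add (integrable_noise hC k).abs).mul_const _)
      (ae_of_all _ fun ω x _ => hasDerivAt_surprisal hC x ω)).2
    refine (norm_sum_le _ _).trans (Finset.sum_le_sum fun k _ => ?_)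
    rw [norm_mul]
    refine mul_le_mul ?_ (abs_bitMean_sub_symbol_le k _ ω) (norm_nonneg _) (by positivity)
    refine (norm_add_le _ _).trans (add_le_add ?_ le_rfl)
    rw [Real.norm_eq_abs, abs_mul, abs_symbol, mul_one, abs_mul, abs_two]
    have := abs_sub_abs_le_abs_sub x s
    rw [Metric.mem_ball, Real.dist_eq] at hx
    linarith
  refine hderiv.congr_deriv ?_
  rw [integral_finsetSum _ fun k _ => integrable_deriv_surprisal hC s k, Finset.mul_sum,
    ← Finset.sum_neg_distrib]
  exact Finset.sum_congr rfl fun k _ => integral_deriv_surprisal hC s k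

end ConditionalEntropy

section ExtrinsicSNR

lemma measurePreserving_prod_mul_gaussianReal {α β : Type*} [MeasurableSpace α]
    [MeasurableSpace β] {μ : Measure α} [SFinite μ] {ν : Measure β} {f : α → β}
    (hf : MeasurePreserving f μ ν) {σ : α → ℝ} (hσ : Measurable σ) (hsq : ∀ x, σ x ^ 2 = 1) :
    MeasurePreserving (fun p : α × ℝ => (f p.1, σ p.1 * p.2)) (μ.prod (gaussianReal 0 1))
      (ν.prod (gaussianReal 0 1)) := by
  refine hf.skew_product (g := fun x t => σ x * t)
    ((hσ.comp measurable_fst).mul measurable_snd) (ae_of_all _ fun x => ?_)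
  rw [gaussianReal_map_const_mul, mul_zero, mul_one]
  congr 1
  exact NNReal.eq (hsq x)

lemma measurePreserving_add_affine_gaussianReal {g : ℝ} (hg : 0 ≤ g) (t : ℝ) :
    MeasurePreserving (fun p : ℝ × ℝ => p.1 + (t ^ 2 + t * p.2))
      ((gaussianReal g g.toNNReal).prod (gaussianReal 0 1))
      (gaussianReal (g + t ^ 2) (g + t ^ 2).toNNReal) where
  measurable := by fun_prop
  map_eq := by
    rw [Real.toNNReal_add hg (sq_nonneg t), ← gaussianReal_conv_gaussianReal,
      ← map_affine_gaussianReal, Measure.conv]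
    nth_rewrite 2 [← Measure.map_id (μ := gaussianReal g g.toNNReal)]
    rw [Measure.map_prod_map _ _ measurable_id (by fun_prop),
      Measure.map_map (by fun_prop) (by fun_prop)]
    rfl

lemma map_bpsk_mul_half_awgnLLRLaw {g : ℝ} (hg : 0 ≤ g) :
    (awgnLLRLaw g).map (fun p => bpsk p.1 * (p.2 / 2)) = gaussianReal g g.toNNReal := by
  have hmp := measurePreserving_snd.comp (measurePreserving_prod_mul_gaussianReal
    (MeasurePreserving.id (uniformOn (Set.univ : Set Bool))) measurable_bpsk bpsk_sq)
  have hllr (p : Bool × ℝ) : bpsk p.1 * (2 * √g * (√g * bpsk p.1 + p.2) / 2) =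
      √g ^ 2 + √g * (bpsk p.1 * p.2) := by
    linear_combination √g ^ 2 * bpsk_sq p.1
  have hlaw := map_affine_gaussianReal √g
  rw [← hmp.map_eq, Measure.map_map (by fun_prop) hmp.measurable, Real.sq_sqrt hg] at hlaw
  rw [awgnLLRLaw, Measure.map_map (by fun_prop) (by fun_prop), ← hlaw]
  congr 1 with p
  exact (hllr p).trans (by rw [Real.sq_sqrt hg]; rfl)

lemma map_fst_awgnLLRLaw (g : ℝ) :
    (awgnLLRLaw g).map Prod.fst = uniformOn (Set.univ : Set Bool) := by
  rw [awgnLLRLaw, Measure.map_map measurable_fst (by fun_prop)]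
  exact measurePreserving_fst.map_eq

variable {n : ℕ} {C : Finset (Fin n → Bool)} {γ g : ℝ}

/-- Half the extrinsic log-likelihood ratio of the `k`-th bit. -/
def extrinsicField (C : Finset (Fin n → Bool)) (γ : ℝ) (k : Fin n) (ω : Sample n) : ℝ :=
  Real.artanh (bitMean C k (channelField (extrinsicAmplitude γ k) ω))

@[fun_prop]
lemma measurable_extrinsicField (γ : ℝ) (k : Fin n) : Measurable (extrinsicField C γ k) := by
  unfold extrinsicField Real.artanh
  fun_prop

/-- `g` is an extrinsic signal-to-noise ratio of the code `C` at the a priori signal-to-noise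
ratio `γ`: it witnesses the Gaussian assumption at `γ`. -/
def IsExtrinsicSNR (C : Finset (Fin n → Bool)) (γ g : ℝ) : Prop :=
  0 ≤ g ∧ ∀ k : Fin n, (codeMeasure C).map (fun ω => (ω.1 k, extLLR C γ k ω)) = awgnLLRLaw g

lemma IsExtrinsicSNR.hasLaw_bit_extrinsicField (hg : IsExtrinsicSNR C γ g) (hC : C.Nonempty)
    (k : Fin n) :
    HasLaw (fun ω => (ω.1 k, 2 * extrinsicField C γ k ω)) (awgnLLRLaw g) (codeMeasure C) where
  aemeasurable := by fun_prop
  map_eq := by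
    rw [← hg.2 k]
    refine Measure.map_congr ?_
    filter_upwards [extLLR_ae_eq hC γ k] with ω hω
    rw [hω, extrinsicField]

lemma IsExtrinsicSNR.hasLaw_bit (hg : IsExtrinsicSNR C γ g) (hC : C.Nonempty) (k : Fin n) :
    HasLaw (fun ω => ω.1 k) (uniformOn (Set.univ : Set Bool)) (codeMeasure C) :=
  HasLaw.comp ⟨measurable_fst.aemeasurable, map_fst_awgnLLRLaw g⟩
    (hg.hasLaw_bit_extrinsicField hC k)

lemma IsExtrinsicSNR.exists_bit_eq (hg : IsExtrinsicSNR C γ g) (hC : C.Nonempty) (k : Fin n)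
    (b : Bool) : ∃ x ∈ C, x k = b := by
  by_contra! hne
  have hnull : codeMeasure C ((fun ω => ω.1 k) ⁻¹' {b}) = 0 := by
    rw [measure_eq_zero_iff_ae_notMem]
    filter_upwards [ae_codeword_mem (C := C)] with ω hω using hne ω.1 hω
  rw [← Measure.map_apply (by fun_prop) (measurableSet_singleton b),
    (hg.hasLaw_bit hC k).map_eq] at hnull
  rw [uniformOn_univ] at hnull
  simp at hnull

lemma IsExtrinsicSNR.integral_symbol (hg : IsExtrinsicSNR C γ g) (hC : C.Nonempty) (k : Fin n) :
    ∫ ω, symbol k ω ∂codeMeasure C = 0 := by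
  refine ((hg.hasLaw_bit hC k).integral_comp (f := bpsk) (by fun_prop)).trans ?_
  have h := integral_uniformOn Finset.univ bpsk
  rw [Finset.coe_univ] at h
  rw [h]
  simp [bpsk]

lemma IsExtrinsicSNR.hasLaw_symbol_mul_extrinsicField (hg : IsExtrinsicSNR C γ g)
    (hC : C.Nonempty) (k : Fin n) :
    HasLaw (fun ω => symbol k ω * extrinsicField C γ k ω) (gaussianReal g g.toNNReal)
      (codeMeasure C) := by
  have hlaw := HasLaw.comp (Y := fun p : Bool × ℝ => bpsk p.1 * (p.2 / 2))
    ⟨Measurable.aemeasurable (by fun_prop), map_bpsk_mul_half_awgnLLRLaw hg.1⟩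
    (hg.hasLaw_bit_extrinsicField hC k)
  refine hlaw.congr (ae_of_all _ fun ω => ?_)
  simp [symbol]

lemma extrinsicField_replaceNoise (γ : ℝ) (k : Fin n) (ω : Sample n) (u : ℝ) :
    extrinsicField C γ k (replaceNoise k ω u) = extrinsicField C γ k ω := by
  have hself : channelField (extrinsicAmplitude γ k) ω k = 0 := by
    simp [channelField, extrinsicAmplitude]
  have hampl : extrinsicAmplitude γ k k = 0 := Function.update_self ..
  rw [extrinsicField, channelField_replaceNoise, hampl, zero_mul, ← hself,
    Function.update_eq_self, extrinsicField]

/-- The observation of the `k`-th bit at amplitude `t` is independent of the extrinsic information,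
so the two signal-to-noise ratios add up. -/
lemma IsExtrinsicSNR.hasLaw_symbol_mul_add (hg : IsExtrinsicSNR C γ g) (hC : C.Nonempty)
    (k : Fin n) (t : ℝ) :
    HasLaw (fun ω => symbol k ω * extrinsicField C γ k ω + (t ^ 2 + t * (symbol k ω * ω.2 k)))
      (gaussianReal (g + t ^ 2) (g + t ^ 2).toNNReal) (codeMeasure C) where
  aemeasurable := by fun_prop
  map_eq := by
    have hevidence : MeasurePreserving (fun ω => symbol k ω * extrinsicField C γ k ω)
        (codeMeasure C) (gaussianReal g g.toNNReal) :=
      ⟨by fun_prop, (hg.hasLaw_symbol_mul_extrinsicField hC k).map_eq⟩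
    have hsum := (measurePreserving_add_affine_gaussianReal hg.1 t).comp
      (measurePreserving_prod_mul_gaussianReal hevidence (measurable_symbol k) (symbol_sq k))
    have hreplace := measurePreserving_replaceNoise (C := C) k
    rw [← hsum.map_eq, ← hreplace.map_eq, Measure.map_map (by fun_prop) hreplace.measurable,
      hreplace.map_eq]
    congr 1 with p
    simp only [Function.comp_apply, extrinsicField_replaceNoise]
    simp [symbol, replaceNoise]

lemma bpsk_mul_tanh (b : Bool) (u : ℝ) : bpsk b * Real.tanh u = Real.tanh (bpsk b * u) := by
  cases b <;> simp [bpsk, Real.tanh_neg]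

lemma IsExtrinsicSNR.integral_symbol_mul_bitMean (hg : IsExtrinsicSNR C γ g) (hC : C.Nonempty)
    (k : Fin n) (t : ℝ) :
    ∫ ω, symbol k ω * bitMean C k (channelField (Function.update (fun _ => √γ) k t) ω)
      ∂codeMeasure C = bitOverlap (g + t ^ 2) := by
  have hbit := hg.exists_bit_eq hC k
  have herase (ω : Sample n) :
      Function.update (channelField (Function.update (fun _ => √γ) k t) ω) k 0 =
        channelField (extrinsicAmplitude γ k) ω := by
    ext j
    by_cases hj : j = k
    · subst hj
      simp [channelField, extrinsicAmplitude]
    · simp [channelField, channelOutput, extrinsicAmplitude, hj]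
  have hself (ω : Sample n) :
      channelField (Function.update (fun _ => √γ) k t) ω k = t * (t * symbol k ω + ω.2 k) := by
    simp [channelField, channelOutput]
  rw [bitOverlap, ← (hg.hasLaw_symbol_mul_add hC k t).integral_comp
    continuous_tanh.aestronglyMeasurable]
  congr 1 with ω
  rw [bitMean_eq_tanh hbit, herase, hself, symbol, bpsk_mul_tanh, ← symbol, ← extrinsicField]
  congr 1
  linear_combination t ^ 2 * symbol_sq k ω

lemma IsExtrinsicSNR.mmseExt_eq (hg : IsExtrinsicSNR C γ g) (hC : C.Nonempty) (hn : 0 < n) :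
    mmseExt C γ = 1 - bitOverlap g := by
  have hoverlap (k : Fin n) :
      ∫ ω, symbol k ω * bitMean C k (channelField (extrinsicAmplitude γ k) ω) ∂codeMeasure C =
        bitOverlap g := by
    simpa [extrinsicAmplitude] using hg.integral_symbol_mul_bitMean hC k 0
  have hn' : (n : ℝ) ≠ 0 := by positivity
  rw [GaussCode.mmseExt_eq hC]
  simp only [hoverlap, Finset.sum_const, Finset.card_univ, Fintype.card_fin, nsmul_eq_mul]
  rw [← mul_assoc, one_div_mul_cancel hn', one_mul]

lemma GaussianExtrinsic.mmseExt_zero (hG : GaussianExtrinsic C) (hC : C.Nonempty) (hn : 0 < n) :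
    mmseExt C 0 = 1 := by
  obtain ⟨g, hg⟩ : ∃ g, IsExtrinsicSNR C 0 g := hG 0 le_rfl
  have hfield (k : Fin n) (ω : Sample n) : channelField (extrinsicAmplitude 0 k) ω = 0 := by
    have hamp : extrinsicAmplitude 0 k = 0 := by
      ext j
      simp [extrinsicAmplitude, Function.update_apply]
    rw [channelField, hamp, zero_mul]
  have hn' : (n : ℝ) ≠ 0 := by positivity
  rw [mmseExt_eq hC]
  simp [hfield, integral_mul_const, hg.integral_symbol hC, hn']

lemma IsExtrinsicSNR.hasDerivAt_condEntropy_div {s : ℝ} (hs : 0 ≤ s)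
    (hg : IsExtrinsicSNR C (s ^ 2) g) (hC : C.Nonempty) (hn : 0 < n) :
    HasDerivAt (fun s => condEntropy C s / n) (-(s * (1 - bitOverlap (g + s ^ 2)))) s := by
  have hn' : (n : ℝ) ≠ 0 := by positivity
  have hoverlap (k : Fin n) := hg.integral_symbol_mul_bitMean hC k s
  simp only [Real.sqrt_sq hs, Function.update_eq_self] at hoverlap
  refine ((hasDerivAt_condEntropy hC s).div_const n).congr_deriv ?_
  simp only [hoverlap, Finset.sum_const, Finset.card_univ, Fintype.card_fin, nsmul_eq_mul]
  field_simp

end ExtrinsicSNR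

section RateComparison

open Filter Topology

lemma le_of_antitoneOn_Ici_of_tendsto {f : ℝ → ℝ} {a l x : ℝ} (hf : AntitoneOn f (Set.Ici a))
    (hlim : Tendsto f atTop (𝓝 l)) (hx : a ≤ x) : l ≤ f x :=
  le_of_tendsto hlim ((eventually_ge_atTop x).mono fun _ hy => hf hx (hx.trans hy) hy)

lemma deriv_eq_zero_of_antitoneOn_Ici_of_tendsto {f : ℝ → ℝ} {a l : ℝ}
    (hf : AntitoneOn f (Set.Ici a)) (hlim : Tendsto f atTop (𝓝 l)) (ha : f a = l) {x : ℝ}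
    (hx : a < x) : deriv f x = 0 := by
  have hconst : f =ᶠ[𝓝 x] fun _ => l := by
    filter_upwards [Ioi_mem_nhds hx] with y hy
    exact ((hf Set.self_mem_Ici (Set.Ioi_subset_Ici_self hy) (le_of_lt hy)).trans_eq ha).antisymm
      (le_of_antitoneOn_Ici_of_tendsto hf hlim (le_of_lt hy))
  rw [hconst.deriv_eq, deriv_const]

variable {n₁ n₂ : ℕ} {C₁ : Finset (Fin n₁ → Bool)} {C₂ : Finset (Fin n₂ → Bool)}

/-- The conditional entropy of `C₁` per channel use in excess of that of `C₂`, both codes being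
observed through Gaussian channels of amplitude `s`. -/
def entropyGap (C₁ : Finset (Fin n₁ → Bool)) (C₂ : Finset (Fin n₂ → Bool)) (s : ℝ) : ℝ :=
  condEntropy C₁ s / n₁ - condEntropy C₂ s / n₂

lemma tendsto_entropyGap (hC₁ : C₁.Nonempty) (hC₂ : C₂.Nonempty) :
    Tendsto (entropyGap C₁ C₂) atTop (𝓝 0) := by
  have hlim := ((tendsto_condEntropy hC₁).div_const (n₁ : ℝ)).sub
    ((tendsto_condEntropy hC₂).div_const (n₂ : ℝ))
  rwa [zero_div, zero_div, sub_zero] at hlim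

lemma differentiable_entropyGap (hC₁ : C₁.Nonempty) (hC₂ : C₂.Nonempty) :
    Differentiable ℝ (entropyGap C₁ C₂) := fun s =>
  (((hasDerivAt_condEntropy hC₁ s).div_const _).sub
    ((hasDerivAt_condEntropy hC₂ s).div_const _)).differentiableAt

lemma rate_sub_rate (hC₁ : C₁.Nonempty) (hC₂ : C₂.Nonempty) :
    rate C₁ - rate C₂ = entropyGap C₁ C₂ 0 / Real.log 2 := by
  rw [rate_eq_condEntropy_zero hC₁, rate_eq_condEntropy_zero hC₂, entropyGap, sub_div]

lemma rate_le_rate_iff (hC₁ : C₁.Nonempty) (hC₂ : C₂.Nonempty) :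
    rate C₂ ≤ rate C₁ ↔ 0 ≤ entropyGap C₁ C₂ 0 := by
  rw [← sub_nonneg, rate_sub_rate hC₁ hC₂, le_div_iff₀ (Real.log_pos one_lt_two), zero_mul]

lemma rate_eq_rate_iff (hC₁ : C₁.Nonempty) (hC₂ : C₂.Nonempty) :
    rate C₁ = rate C₂ ↔ entropyGap C₁ C₂ 0 = 0 := by
  rw [← sub_eq_zero, rate_sub_rate hC₁ hC₂, div_eq_zero_iff,
    or_iff_left (Real.log_pos one_lt_two).ne']

lemma hasDerivAt_entropyGap (hC₁ : C₁.Nonempty) (hC₂ : C₂.Nonempty) (hn₁ : 0 < n₁) (hn₂ : 0 < n₂)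
    {s g₁ g₂ : ℝ} (hs : 0 ≤ s) (hg₁ : IsExtrinsicSNR C₁ (s ^ 2) g₁)
    (hg₂ : IsExtrinsicSNR C₂ (s ^ 2) g₂) :
    HasDerivAt (entropyGap C₁ C₂) (s * (bitOverlap (g₁ + s ^ 2) - bitOverlap (g₂ + s ^ 2))) s :=
  ((hg₁.hasDerivAt_condEntropy_div hs hC₁ hn₁).sub
    (hg₂.hasDerivAt_condEntropy_div hs hC₂ hn₂)).congr_deriv (by ring)

lemma IsExtrinsicSNR.le_of_mmseExt_le {γ g₁ g₂ : ℝ} (hg₁ : IsExtrinsicSNR C₁ γ g₁)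
    (hg₂ : IsExtrinsicSNR C₂ γ g₂) (hC₁ : C₁.Nonempty) (hC₂ : C₂.Nonempty) (hn₁ : 0 < n₁)
    (hn₂ : 0 < n₂) (hle : mmseExt C₂ γ ≤ mmseExt C₁ γ) : g₁ ≤ g₂ := by
  rw [hg₁.mmseExt_eq hC₁ hn₁, hg₂.mmseExt_eq hC₂ hn₂, sub_le_sub_iff_left] at hle
  exact (strictMonoOn_bitOverlap.le_iff_le hg₁.1 hg₂.1).1 hle

lemma antitoneOn_entropyGap (hC₁ : C₁.Nonempty) (hC₂ : C₂.Nonempty) (hn₁ : 0 < n₁) (hn₂ : 0 < n₂)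
    (hG₁ : GaussianExtrinsic C₁) (hG₂ : GaussianExtrinsic C₂)
    (hle : ∀ γ, 0 ≤ γ → mmseExt C₂ γ ≤ mmseExt C₁ γ) :
    AntitoneOn (entropyGap C₁ C₂) (Set.Ici 0) := by
  have hdiff := differentiable_entropyGap hC₁ hC₂
  refine antitoneOn_of_deriv_nonpos (convex_Ici 0) hdiff.continuous.continuousOn
    hdiff.differentiableOn fun s hs => ?_
  rw [interior_Ici, Set.mem_Ioi] at hs
  obtain ⟨g₁, hg₁⟩ : ∃ g, IsExtrinsicSNR C₁ (s ^ 2) g := hG₁ _ (sq_nonneg s)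
  obtain ⟨g₂, hg₂⟩ : ∃ g, IsExtrinsicSNR C₂ (s ^ 2) g := hG₂ _ (sq_nonneg s)
  have hg := hg₁.le_of_mmseExt_le hg₂ hC₁ hC₂ hn₁ hn₂ (hle _ (sq_nonneg s))
  rw [(hasDerivAt_entropyGap hC₁ hC₂ hn₁ hn₂ hs.le hg₁ hg₂).deriv]
  exact mul_nonpos_of_nonneg_of_nonpos hs.le (sub_nonpos.2 <| strictMonoOn_bitOverlap.monotoneOn
    (add_nonneg hg₁.1 (sq_nonneg s)) (add_nonneg hg₂.1 (sq_nonneg s)) (by gcongr))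

lemma mmseExt_eq_of_deriv_entropyGap_eq_zero (hC₁ : C₁.Nonempty) (hC₂ : C₂.Nonempty)
    (hn₁ : 0 < n₁) (hn₂ : 0 < n₂) (hG₁ : GaussianExtrinsic C₁) (hG₂ : GaussianExtrinsic C₂) {s : ℝ}
    (hs : 0 < s) (hderiv : deriv (entropyGap C₁ C₂) s = 0) :
    mmseExt C₁ (s ^ 2) = mmseExt C₂ (s ^ 2) := by
  obtain ⟨g₁, hg₁⟩ : ∃ g, IsExtrinsicSNR C₁ (s ^ 2) g := hG₁ _ (sq_nonneg s)
  obtain ⟨g₂, hg₂⟩ : ∃ g, IsExtrinsicSNR C₂ (s ^ 2) g := hG₂ _ (sq_nonneg s)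
  rw [(hasDerivAt_entropyGap hC₁ hC₂ hn₁ hn₂ hs.le hg₁ hg₂).deriv, mul_eq_zero_iff_left hs.ne',
    sub_eq_zero, strictMonoOn_bitOverlap.eq_iff_eq (add_nonneg hg₁.1 (sq_nonneg s))
      (add_nonneg hg₂.1 (sq_nonneg s)), add_left_inj] at hderiv
  rw [hg₁.mmseExt_eq hC₁ hn₁, hg₂.mmseExt_eq hC₂ hn₂, hderiv]

end RateComparison

end GaussCode

end

theorem lemma4 {n₁ n₂ : ℕ} (hn₁ : 0 < n₁) (hn₂ : 0 < n₂)
    (C₁ : Finset (Fin n₁ → Bool)) (C₂ : Finset (Fin n₂ → Bool))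
    (hC₁ : C₁.Nonempty) (hC₂ : C₂.Nonempty)
    (hG₁ : GaussCode.GaussianExtrinsic C₁) (hG₂ : GaussCode.GaussianExtrinsic C₂)
    (hle : ∀ γ : ℝ, 0 ≤ γ → 1 - GaussCode.mmseExt C₁ γ ≤ 1 - GaussCode.mmseExt C₂ γ) :
    GaussCode.rate C₂ ≤ GaussCode.rate C₁ ∧
      (GaussCode.rate C₁ = GaussCode.rate C₂ →
        ∀ γ : ℝ, 0 ≤ γ → GaussCode.mmseExt C₁ γ = GaussCode.mmseExt C₂ γ) := by
  have hanti : AntitoneOn (GaussCode.entropyGap C₁ C₂) (Set.Ici 0) :=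
    GaussCode.antitoneOn_entropyGap hC₁ hC₂ hn₁ hn₂ hG₁ hG₂ fun γ hγ =>
      (sub_le_sub_iff_left 1).1 (hle γ hγ)
  have hlim := GaussCode.tendsto_entropyGap hC₁ hC₂
  rw [GaussCode.rate_le_rate_iff hC₁ hC₂, GaussCode.rate_eq_rate_iff hC₁ hC₂]
  refine ⟨GaussCode.le_of_antitoneOn_Ici_of_tendsto hanti hlim le_rfl, fun hrate γ hγ => ?_⟩
  obtain rfl | hγ := hγ.eq_or_lt
  · rw [hG₁.mmseExt_zero hC₁ hn₁, hG₂.mmseExt_zero hC₂ hn₂]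
  · rw [← Real.sq_sqrt hγ.le]
    have hs : 0 < √γ := Real.sqrt_pos.2 hγ
    exact GaussCode.mmseExt_eq_of_deriv_entropyGap_eq_zero hC₁ hC₂ hn₁ hn₂ hG₁ hG₂ hs
      (GaussCode.deriv_eq_zero_of_antitoneOn_Ici_of_tendsto hanti hlim hrate hs)
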